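/- Let $m>0$, $\ell>0$ and $a\in\mathbb R$, and put $$\Sigma=r^2+a^2\cos^2\theta,\qquad \Delta=r^2+a^2-2mr\,e^{-\ell/r},\qquad \Xi=\frac{\ell\Sigma}{2r^3},\qquad M=m\,e^{-\ell/r}.$$ The eye of the storm metric, in coordinates $(t,r,\theta,\phi)$ with $r>0$, $0<\theta<\pi$, $\Delta\neq0$, is $$ds^2=\frac{\Sigma}{\Delta}dr^2+\Sigma\,d\theta^2-\frac{\Delta}{\Sigma}(dt-a\sin^2\theta\,d\phi)^2+\frac{\sin^2\theta}{\Sigma}\bigl[(r^2+a^2)d\phi-a\,dt\bigr]^2 .$$ Hatted components refer to the co-tetrad $$e^{\hat t}=-\sqrt{|\Delta|/\Sigma}\,(dt-a\sin^2\theta\,d\phi),\quad e^{\hat r}=\sqrt{\Sigma/|\Delta|}\,dr,\quad e^{\hat\theta}=\sqrt\Sigma\,d\theta,\quad e^{\hat\phi}=\frac{\sin\theta}{\sqrt\Sigma}\bigl[(r^2+a^2)d\phi-a\,dt\bigr]$$ and its dual tetrad; it is orthonormal with signature $\mathrm{diag}(-s,s,1,1)$, where $s=\operatorname{sgn}\Delta$.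 The Riemann tensor is $R^{\mu}{}_{\nu\alpha\beta}=\partial_\alpha\Gamma^\mu_{\nu\beta}-\partial_\beta\Gamma^\mu_{\nu\alpha}+\Gamma^\mu_{\sigma\alpha}\Gamma^\sigma_{\nu\beta}-\Gamma^\mu_{\sigma\beta}\Gamma^\sigma_{\nu\alpha}$, $R_{\mu\nu}=R^\sigma{}_{\mu\sigma\nu}$, $G_{\mu\nu}=R_{\mu\nu}-\frac12Rg_{\mu\nu}$, and $T_{\mu\nu}=\frac1{8\pi}G_{\mu\nu}$. Then: 1. **Riemann tensor.** Up to the symmetries of the Riemann tensor, its only nonzero orthonormal components are $$R^{\hat t\hat r}{}_{\hat t\hat r}=\frac{2r^3M}{\Sigma^3}\Bigl[2\Xi^2-4\Xi+1-3\tfrac{a^2}{r^2}\cos^2\theta\Bigr],\qquad R^{\hat\theta\hat\phi}{}_{\hat\theta\hat\phi}=\frac{2r^3M}{\Sigma^3}\Bigl[1-3\tfrac{a^2}{r^2}\cos^2\theta\Bigr],$$ $$R^{\hat t\hat\theta}{}_{\hat t\hat\theta}=R^{\hat t\hat\phi}{}_{\hat t\hat\phi}=R^{\hat r\hat\theta}{}_{\hat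 r\hat\theta}=R^{\hat r\hat\phi}{}_{\hat r\hat\phi}=\frac{r^3M}{\Sigma^3}\Bigl[2\Xi+3\tfrac{a^2}{r^2}\cos^2\theta-1\Bigr],$$ $$-\tfrac12R^{\hat t\hat r}{}_{\hat\theta\hat\phi}=-s\,R^{\hat t\hat\theta}{}_{\hat r\hat\phi}=s\,R^{\hat t\hat\phi}{}_{\hat r\hat\theta}=\frac{a\cos\theta\,r^2M}{\Sigma^3}\Bigl[2\Xi+\tfrac{a^2}{r^2}\cos^2\theta-3\Bigr].$$ In particular every orthonormal component equals, up to a possible factor $s$, $\dfrac{m\,e^{-\ell/r}}{r^n\,\Sigma^3}X$, where for each choice of indices $n\in\mathbb N$ and $X$, a polynomial in $r,\cos\theta,a,\ell$, do not depend on $m$, $a$, $\ell$ or the point. 2. **Regularity.** For fixed $m,a,\ell$ all orthonormal Riemann components are bounded on the whole chart (curvature-regularity). As $r\to0^+$ they tend to zero uniformly in the other coordinates, as do the energy density and the pressures below, and $m\,e^{-\ell/r}=o(r^3)$ (asymptotically Minkowski core). 3. **Einstein tensor.** $G^{\hat\mu}{}_{\hat\nu}=-\dfrac{2\ell m\,e^{-\ell/r}}{\Sigma^2}\,\mathrm{diag}(1,1,\Xi-1,\Xi-1)$.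 4. **Stress-energy.** Let $\rho=T(e,e)$ for $e$ the timelike one of $e_{\hat t},e_{\hat r}$, let $p_r=T(e',e')$ for $e'$ the spacelike one, and $p_t=T(e_{\hat\theta},e_{\hat\theta})$. Then $T^{\hat\mu}{}_{\hat\nu}=\mathrm{diag}(-\rho,p_r,p_t,p_t)$ and $$\rho=-p_r=\frac{\ell m\,e^{-\ell/r}}{4\pi\Sigma^2}>0,\qquad p_t=\frac{\ell m\,e^{-\ell/r}}{4\pi\Sigma^2}(1-\Xi).$$ 5. **Energy conditions.** At every point of the chart: $T(k,k)\ge0$ for all null $k$ in the plane of $e_{\hat t},e_{\hat r}$ (radial NEC). The transverse NEC ($T(k,k)\ge0$ for null $k$ in the plane of the timelike leg and $e_{\hat\theta}$, or of the timelike leg and $e_{\hat\phi}$) fails if and only if $\rho+p_t<0$, if and only if $\Xi>2$; the full NEC ($T(k,k)\ge0$ for all null $k$) fails if and only if $\Xi>2$. The SEC ($(T_{\mu\nu}-\frac12Tg_{\mu\nu})V^\mu V^\nu\ge0$ for all timelike $V$) fails if and only if $\rho+p_r+2p_t<0$, if and only if $\Xi>1$. On the equatorial plane $\theta=\pi/2$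 these failures occur exactly for $r<\ell/4$ and $r<\ell/2$ respectively. 6. **Deep core.** For every $a\in\mathbb R$ and $\delta>0$ there is $\ell_0>0$ such that for all $m>0$ and $0<\ell<\ell_0$ the NEC and the SEC can fail only at points with $r<\delta$. -/

import Mathlib

open Real Filter Topology
open scoped Matrix

noncomputable section

namespace LorentzChart

/-! Pseudo-Riemannian geometry in one coordinate chart of a four-manifold. -/

/-- A point of the chart, or the coordinate components of a vector. -/
abbrev Vec4 := Fin 4 → ℝ

/-- Four-by-four real matrices. -/
abbrev Mat4 := Matrix (Fin 4) (Fin 4) ℝ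

/-- The partial derivative `∂_μ f` at `x`. -/
def pd (μ : Fin 4) (f : Vec4 → ℝ) (x : Vec4) : ℝ :=
  deriv (fun s : ℝ => f (Function.update x μ s)) (x μ)

/-- Christoffel symbols `Γ^μ_{αβ}` of the metric field `g`. -/
def christoffel (g : Vec4 → Mat4) (μ α β : Fin 4) (x : Vec4) : ℝ :=
  1 / 2 * ∑ ν, (g x)⁻¹ μ ν *
    (pd α (fun y => g y ν β) x + pd β (fun y => g y ν α) x - pd ν (fun y => g y α β) x)

/-- The Riemann tensor `R^μ_{ναβ}`. -/
def riemann (g : Vec4 → Mat4) (μ ν α β : Fin 4) (x : Vec4) : ℝ :=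
  pd α (christoffel g μ ν β) x - pd β (christoffel g μ ν α) x
    + ∑ σ, (christoffel g μ σ α x * christoffel g σ ν β x
      - christoffel g μ σ β x * christoffel g σ ν α x)

/-- The Ricci tensor `R_{μν} = R^σ_{μσν}`. -/
def ricci (g : Vec4 → Mat4) (x : Vec4) : Mat4 :=
  Matrix.of fun μ ν => ∑ σ, riemann g σ μ σ ν x

/-- The Ricci scalar `g^{μν} R_{μν}`. -/
def ricciScalar (g : Vec4 → Mat4) (x : Vec4) : ℝ :=
  ∑ μ, ∑ ν, (g x)⁻¹ μ ν * ricci g x μ ν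

/-- The Einstein tensor `G_{μν} = R_{μν} - (1/2) R g_{μν}`. -/
def einstein (g : Vec4 → Mat4) (x : Vec4) : Mat4 :=
  ricci g x - (1 / 2 * ricciScalar g x) • g x

/-- The stress-energy tensor `T_{μν}` determined by the Einstein equations
`G_{μν} = 8 π T_{μν}` (units with `c = G_N = 1`). -/
def stressEnergy (g : Vec4 → Mat4) (x : Vec4) : Mat4 :=
  (1 / (8 * π)) • einstein g x

/-- The value `A_{μν} u^μ v^ν` of a covariant two-tensor on two vectors. -/
def eval2 (A : Mat4) (u v : Vec4) : ℝ := ∑ μ, ∑ ν, A μ ν * u μ * v ν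

/-- Null energy condition at a point with metric `g` and stress-energy `T`. -/
def NullEnergyCondition (g T : Mat4) : Prop :=
  ∀ k : Vec4, eval2 g k k = 0 → 0 ≤ eval2 T k k

/-- The null energy condition restricted to null vectors in the plane spanned by `u`, `v`. -/
def NullEnergyConditionIn (g T : Mat4) (u v : Vec4) : Prop :=
  ∀ b c : ℝ, eval2 g (b • u + c • v) (b • u + c • v) = 0 →
    0 ≤ eval2 T (b • u + c • v) (b • u + c • v)

/-- Strong energy condition at a point:
`(T_{μν} - (1/2) T g_{μν}) V^μ V^ν ≥ 0` for every timelike `V`. -/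
def StrongEnergyCondition (g T : Mat4) : Prop :=
  ∀ V : Vec4, eval2 g V V < 0 →
    0 ≤ eval2 (T - (1 / 2 * ∑ μ, ∑ ν, g⁻¹ μ ν * T μ ν) • g) V V

end LorentzChart

namespace EyeOfStorm

open LorentzChart

/-! The eye of the storm spacetime, coordinates `(t, r, θ, φ)` numbered `0, 1, 2, 3`. -/

/-- The mass function `m(r) = m e^{-ℓ/r}`. -/
def massFn (m ℓ r : ℝ) : ℝ := m * exp (-ℓ / r)

/-- `Σ = r² + a² cos² θ`. -/
def Sig (a : ℝ) (x : Vec4) : ℝ := x 1 ^ 2 + a ^ 2 * cos (x 2) ^ 2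

/-- `Δ = r² + a² - 2 m r e^{-ℓ/r}`. -/
def Del (m a ℓ : ℝ) (x : Vec4) : ℝ := x 1 ^ 2 + a ^ 2 - 2 * m * x 1 * exp (-ℓ / x 1)

/-- `Ξ = ℓ Σ / (2 r³)`. -/
def Xi (a ℓ : ℝ) (x : Vec4) : ℝ := ℓ * Sig a x / (2 * x 1 ^ 3)

/-- The points of the Boyer-Lindquist chart: `r > 0`, `0 < θ < π`, away from the horizons
`Δ = 0`, where these coordinates break down. -/
def chart (m a ℓ : ℝ) : Set Vec4 := {x | 0 < x 1 ∧ 0 < x 2 ∧ x 2 < π ∧ Del m a ℓ x ≠ 0}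

/-- The one-form `dt - a sin² θ dφ`. -/
def formT (a : ℝ) (x : Vec4) : Vec4 := ![1, 0, 0, -(a * sin (x 2) ^ 2)]

/-- The one-form `(r² + a²) dφ - a dt`. -/
def formPhi (a : ℝ) (x : Vec4) : Vec4 := ![-a, 0, 0, x 1 ^ 2 + a ^ 2]

/-- The one-form `dr`. -/
def formR : Vec4 := ![0, 1, 0, 0]

/-- The one-form `dθ`. -/
def formTheta : Vec4 := ![0, 0, 1, 0]

/-- The eye of the storm metric
`(Σ/Δ) dr² + Σ dθ² - (Δ/Σ) (dt - a sin² θ dφ)² + (sin² θ/Σ) ((r² + a²) dφ - a dt)²`. -/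
def metric (m a ℓ : ℝ) (x : Vec4) : Mat4 :=
  Matrix.of fun μ ν =>
    Sig a x / Del m a ℓ x * (formR μ * formR ν)
      + Sig a x * (formTheta μ * formTheta ν)
      - Del m a ℓ x / Sig a x * (formT a x μ * formT a x ν)
      + sin (x 2) ^ 2 / Sig a x * (formPhi a x μ * formPhi a x ν)

/-- The co-tetrad `e^α_μ` (row `α`). The absolute value makes it real also where `Δ < 0`. -/
def cotetrad (m a ℓ : ℝ) (x : Vec4) : Mat4 :=
  Matrix.of ![
    (-√(|Del m a ℓ x| / Sig a x)) • formT a x,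
    √(Sig a x / |Del m a ℓ x|) • formR,
    √(Sig a x) • formTheta,
    (sin (x 2) / √(Sig a x)) • formPhi a x]

/-- The tetrad `e_α^μ` (row `α`). -/
def tetrad (m a ℓ : ℝ) (x : Vec4) : Mat4 :=
  Matrix.of ![
    (-(1 / √(Sig a x * |Del m a ℓ x|))) • ![x 1 ^ 2 + a ^ 2, 0, 0, a],
    √(|Del m a ℓ x| / Sig a x) • ![0, 1, 0, 0],
    (1 / √(Sig a x)) • ![0, 0, 1, 0],
    (1 / (√(Sig a x) * sin (x 2))) • ![a * sin (x 2) ^ 2, 0, 0, 1]]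

/-- The Minkowski metric in the tetrad basis: `diag(-1, 1, 1, 1)` where `Δ > 0`, and
`diag(1, -1, 1, 1)` where `Δ < 0`, since there `e_r` is timelike and `e_t` spacelike. -/
def eta (m a ℓ : ℝ) (x : Vec4) : Fin 4 → ℝ :=
  ![-Real.sign (Del m a ℓ x), Real.sign (Del m a ℓ x), 1, 1]

/-- Orthonormal components `R^{αβ}_{μν}` of the Riemann tensor. -/
def orthoRiemann (m a ℓ : ℝ) (x : Vec4) (α β μ ν : Fin 4) : ℝ :=
  ∑ i, ∑ j, ∑ k, ∑ p, ∑ q,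
    cotetrad m a ℓ x α i * cotetrad m a ℓ x β j * tetrad m a ℓ x μ p * tetrad m a ℓ x ν q *
      ((metric m a ℓ x)⁻¹ j k * riemann (metric m a ℓ) i k p q x)

/-- Orthonormal mixed components `A^α_β` of a covariant two-tensor `A_{μν}` at `x`. -/
def orthoMixed (m a ℓ : ℝ) (x : Vec4) (A : Mat4) (α β : Fin 4) : ℝ :=
  ∑ i, ∑ j, ∑ p,
    cotetrad m a ℓ x α i * (metric m a ℓ x)⁻¹ i j * A j p * tetrad m a ℓ x β p

/-- Orthonormal components `G^α_β` of the Einstein tensor. -/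
def orthoEinstein (m a ℓ : ℝ) (x : Vec4) : Fin 4 → Fin 4 → ℝ :=
  orthoMixed m a ℓ x (einstein (metric m a ℓ) x)

/-- The stress-energy tensor `T_{μν}` of the eye of the storm. -/
def stress (m a ℓ : ℝ) (x : Vec4) : Mat4 := stressEnergy (metric m a ℓ) x

/-- The timelike leg of the tetrad: `e_t` where `Δ > 0`, `e_r` where `Δ < 0`. -/
def timeLeg (m a ℓ : ℝ) (x : Vec4) : Vec4 :=
  if 0 < Del m a ℓ x then tetrad m a ℓ x 0 else tetrad m a ℓ x 1

/-- The spacelike one of the two legs `e_t`, `e_r`. -/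
def radialLeg (m a ℓ : ℝ) (x : Vec4) : Vec4 :=
  if 0 < Del m a ℓ x then tetrad m a ℓ x 1 else tetrad m a ℓ x 0

/-- The energy density `ρ`. -/
def rho (m a ℓ : ℝ) (x : Vec4) : ℝ :=
  eval2 (stress m a ℓ x) (timeLeg m a ℓ x) (timeLeg m a ℓ x)

/-- The radial pressure `p_r`. -/
def pr (m a ℓ : ℝ) (x : Vec4) : ℝ :=
  eval2 (stress m a ℓ x) (radialLeg m a ℓ x) (radialLeg m a ℓ x)

/-- The transverse pressure `p_t`. -/
def pt (m a ℓ : ℝ) (x : Vec4) : ℝ :=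
  eval2 (stress m a ℓ x) (tetrad m a ℓ x 2) (tetrad m a ℓ x 2)

/-- The null energy condition. -/
def NEC (m a ℓ : ℝ) (x : Vec4) : Prop :=
  NullEnergyCondition (metric m a ℓ x) (stress m a ℓ x)

/-- The radial null energy condition: null vectors in the plane of `e_t` and `e_r`. -/
def RadialNEC (m a ℓ : ℝ) (x : Vec4) : Prop :=
  NullEnergyConditionIn (metric m a ℓ x) (stress m a ℓ x) (timeLeg m a ℓ x) (radialLeg m a ℓ x)

/-- The transverse null energy condition: null vectors in the planes spanned by the timelike
leg and `e_θ`, respectively `e_φ`. -/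
def TransverseNEC (m a ℓ : ℝ) (x : Vec4) : Prop :=
  NullEnergyConditionIn (metric m a ℓ x) (stress m a ℓ x) (timeLeg m a ℓ x) (tetrad m a ℓ x 2) ∧
  NullEnergyConditionIn (metric m a ℓ x) (stress m a ℓ x) (timeLeg m a ℓ x) (tetrad m a ℓ x 3)

/-- The strong energy condition. -/
def SEC (m a ℓ : ℝ) (x : Vec4) : Prop :=
  StrongEnergyCondition (metric m a ℓ x) (stress m a ℓ x)

/-- Curvature regularity: all orthonormal Riemann components are bounded on the whole chart,
so none of them diverges anywhere, in particular not as `r → 0`, at the horizons or on the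
axis. -/
def CurvatureRegular (m a ℓ : ℝ) : Prop :=
  ∃ C : ℝ, ∀ x ∈ chart m a ℓ, ∀ α β μ ν : Fin 4, |orthoRiemann m a ℓ x α β μ ν| ≤ C

/-- Asymptotically Minkowski core: all orthonormal Riemann components, and with them the
energy density and pressures, tend to zero as `r → 0⁺`, uniformly in the other coordinates. -/
def AsymptoticallyMinkowskiCore (m a ℓ : ℝ) : Prop :=
  ∀ ε > 0, ∃ δ > 0, ∀ x ∈ chart m a ℓ, x 1 < δ →
    (∀ α β μ ν : Fin 4, |orthoRiemann m a ℓ x α β μ ν| < ε) ∧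
    |rho m a ℓ x| < ε ∧ |pr m a ℓ x| < ε ∧ |pt m a ℓ x| < ε

end EyeOfStorm

end

open LorentzChart EyeOfStorm

/-! The curvature is computed by Cartan's method, in a rational frame instead of the tetrad. The
forms dt - a sin²θ dφ, dr, d cos θ, (r² + a²) dφ - a dt contain no square roots, and in them the
metric is diag(-Δ/Σ, Σ/Δ, Σ/sin²θ, sin²θ/Σ), so that all coefficients are rational in a, r, y = cos
θ and Δ. A torsion-free metric connection form `connTerm` is written down explicitly. Such a form
determines the Christoffel symbols (`christoffel_of_frame`), and its curvature is the Riemann tensor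
(`riemann_of_frame`, `curvature_of_frame_components`). With Δ, Δ', Δ'' taken as independent numbers,
everything reduces to identities between rational functions. The outcome is four scalars `Jet.kA`,
`Jet.kB`, `Jet.kC`, `Jet.kD`, linear in Δ - r² - a² and its first two derivatives; the special form
of Δ enters only when they are evaluated.

The tetrad arises from this frame by the diagonal rescaling `normFactor`, which turns the curvature
into `riemannTable` (`orthoRiemann_eq`). The symmetries, the vanishing components and the general
form of the components are then read off a finite table.

The scalar `Jet.kD` drops out of the Ricci contraction, so the Ricci and Einstein tensors are
diagonal in the tetrad (`ricci_curvature`, `einstein_metric`), and the mixed stress tensor is ρ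
diag(-1, -1, 1 - Ξ, 1 - Ξ) (`stress_eq`). For null k this gives T(k,k) = ρ (2 - Ξ) times the squared
length of the transverse part of k. In the strong energy condition the timelike leg itself
contributes ρ (1 - Ξ), and this sign decides the matter. Hence `NEC_iff` and `SEC_iff`.

For regularity, Σ ≥ r² bounds every component by m e^{-ℓ/r} times a polynomial in 1/r, uniformly in
the angles, and the exponential beats every power of 1/r (`exp_neg_div_mul_pow_le`). -/

namespace LorentzChart

/-! ### Calculus of partial derivatives for functions and matrix fields. -/

/-- `f` has partial derivative `f'` in the direction of the coordinate `μ` at `x`. -/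
def HasPd (μ : Fin 4) (f : Vec4 → ℝ) (f' : ℝ) (x : Vec4) : Prop :=
  HasDerivAt (fun s : ℝ => f (Function.update x μ s)) f' (x μ)

namespace HasPd

variable {μ : Fin 4} {f g : Vec4 → ℝ} {f' g' : ℝ} {x : Vec4}

theorem pd_eq (h : HasPd μ f f' x) : pd μ f x = f' := h.deriv

theorem unique (h : HasPd μ f f' x) (h' : HasPd μ f g' x) : f' = g' := HasDerivAt.unique h h'

theorem const (c : ℝ) : HasPd μ (fun _ => c) 0 x := hasDerivAt_const _ _

theorem add (hf : HasPd μ f f' x) (hg : HasPd μ g g' x) :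
    HasPd μ (fun y => f y + g y) (f' + g') x := HasDerivAt.add hf hg

theorem mul (hf : HasPd μ f f' x) (hg : HasPd μ g g' x) :
    HasPd μ (fun y => f y * g y) (f' * g x + f x * g') x := by
  have h := HasDerivAt.mul hf hg
  simp only [Function.update_eq_self] at h
  exact h

theorem sum {ι : Type*} {s : Finset ι} {F : ι → Vec4 → ℝ} {F' : ι → ℝ}
    (h : ∀ i ∈ s, HasPd μ (F i) (F' i) x) :
    HasPd μ (fun y => ∑ i ∈ s, F i y) (∑ i ∈ s, F' i) x := HasDerivAt.fun_sum h

theorem congr (h : HasPd μ f f' x) (hfg : g =ᶠ[𝓝 x] f) : HasPd μ g f' x := by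
  have ht : Tendsto (fun s : ℝ => Function.update x μ s) (𝓝 (x μ)) (𝓝 x) := by
    have : Continuous fun s : ℝ => Function.update x μ s := by fun_prop
    simpa using this.tendsto (x μ)
  exact HasDerivAt.congr_of_eventuallyEq h (ht.eventually hfg)

end HasPd

/-- Entrywise partial derivative of a matrix field. -/
def HasPdM (μ : Fin 4) (F : Vec4 → Mat4) (F' : Mat4) (x : Vec4) : Prop :=
  ∀ i j, HasPd μ (fun y => F y i j) (F' i j) x

namespace HasPdM

variable {μ : Fin 4} {F G : Vec4 → Mat4} {F' G' : Mat4} {x : Vec4}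

theorem unique (h : HasPdM μ F F' x) (h' : HasPdM μ F G' x) : F' = G' := by
  ext i j
  exact (h i j).unique (h' i j)

theorem const (C : Mat4) : HasPdM μ (fun _ => C) 0 x := fun _ _ => HasPd.const _

theorem add (hF : HasPdM μ F F' x) (hG : HasPdM μ G G' x) :
    HasPdM μ (fun y => F y + G y) (F' + G') x := fun i j => (hF i j).add (hG i j)

theorem mul (hF : HasPdM μ F F' x) (hG : HasPdM μ G G' x) :
    HasPdM μ (fun y => F y * G y) (F' * G x + F x * G') x := by
  intro i j
  have h := HasPd.sum (s := Finset.univ) fun k _ => (hF i k).mul (hG k j)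
  simpa [Matrix.mul_apply, Finset.sum_add_distrib] using h

theorem smul {f : Vec4 → ℝ} {f' : ℝ} (hf : HasPd μ f f' x) (hG : HasPdM μ G G' x) :
    HasPdM μ (fun y => f y • G y) (f' • G x + f x • G') x := fun i j => hf.mul (hG i j)

theorem sum {ι : Type*} {s : Finset ι} {H : ι → Vec4 → Mat4} {H' : ι → Mat4}
    (h : ∀ i ∈ s, HasPdM μ (H i) (H' i) x) :
    HasPdM μ (fun y => ∑ i ∈ s, H i y) (∑ i ∈ s, H' i) x := by
  intro i j
  have h := HasPd.sum (s := s) fun k hk => h k hk i j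
  simpa [Matrix.sum_apply] using h

theorem transpose (hF : HasPdM μ F F' x) : HasPdM μ (fun y => (F y)ᵀ) F'ᵀ x :=
  fun i j => hF j i

theorem congr (h : HasPdM μ F F' x) (hFG : G =ᶠ[𝓝 x] F) : HasPdM μ G F' x :=
  fun i j => (h i j).congr (hFG.mono fun y hy => by simp only [hy])

end HasPdM

/-! ### Cartan's structure equations in a general frame. -/

section Frame

variable {g θ E h : Vec4 → Mat4} {x : Vec4}

theorem metric_inv_of_frame {g θ E h k : Mat4} (hg : g = θᵀ * h * θ) (hE : θ * E = 1)
    (hk : h * k = 1) : g⁻¹ = E * k * Eᵀ := by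
  have hE' : Eᵀ * θᵀ = 1 := by rw [← Matrix.transpose_mul, hE, Matrix.transpose_one]
  have hE2 : θᵀ * Eᵀ = 1 := mul_eq_one_comm.mp hE'
  apply Matrix.inv_eq_right_inv
  calc g * (E * k * Eᵀ) = θᵀ * h * (θ * E) * k * Eᵀ := by rw [hg]; noncomm_ring
    _ = θᵀ * (h * k) * Eᵀ := by rw [hE]; noncomm_ring
    _ = 1 := by rw [hk, mul_one, hE2]

/-- First structure equation: a torsion-free metric connection form `Ω` in the frame `θ`
determines the Christoffel symbols. -/
theorem christoffel_of_frame {A Ω : Fin 4 → Mat4} {k : Mat4}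
    (hg : g =ᶠ[𝓝 x] fun y => (θ y)ᵀ * h y * θ y) (hE : θ x * E x = 1) (hk : h x * k = 1)
    (hsym : (h x)ᵀ = h x) (hA : ∀ μ, HasPdM μ θ (A μ) x)
    (hh : ∀ μ, HasPdM μ h (h x * Ω μ + (Ω μ)ᵀ * h x) x)
    (htors : ∀ μ ν a, (A μ + Ω μ * θ x) a ν = (A ν + Ω ν * θ x) a μ) (μ ν α : Fin 4) :
    christoffel g μ ν α x = (E x * (A α + Ω α * θ x)) μ ν := by
  -- `P α` is the Christoffel symbol with its upper index lowered. Metric compatibility writes ∂_α g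
  -- as its symmetrization.
  set P : Fin 4 → Mat4 := fun α => (θ x)ᵀ * h x * (A α + Ω α * θ x) with hP
  have hdg : ∀ α, HasPdM α g (P α + (P α)ᵀ) x := by
    intro α
    have h1 := (((hA α).transpose.mul (hh α)).mul (hA α)).congr hg
    convert h1 using 1
    simp only [hP, Matrix.transpose_mul, Matrix.transpose_add, Matrix.transpose_transpose, hsym]
    noncomm_ring
  -- Vanishing torsion is the symmetry of the lowered symbols in their last two indices. With it,
  -- the usual combination of three derivatives of g collapses to twice one symbol.
  have hsw : ∀ μ ν a, P μ a ν = P ν a μ := by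
    intro μ ν a
    simp only [hP, Matrix.mul_apply (M := (θ x)ᵀ * h x), htors μ ν]
  have hpd : ∀ α i j, pd α (fun y => g y i j) x = P α i j + P α j i :=
    fun α i j => (hdg α i j).pd_eq
  have hinv := metric_inv_of_frame hg.eq_of_nhds hE hk
  have hE' : (E x)ᵀ * (θ x)ᵀ = 1 := by rw [← Matrix.transpose_mul, hE, Matrix.transpose_one]
  have hkh : k * h x = 1 := mul_eq_one_comm.mp hk
  have hgP : (g x)⁻¹ * P α = E x * (A α + Ω α * θ x) := by
    calc (g x)⁻¹ * P α = E x * k * ((E x)ᵀ * (θ x)ᵀ) * h x * (A α + Ω α * θ x) := by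
          rw [hinv, hP]; noncomm_ring
      _ = E x * (k * h x) * (A α + Ω α * θ x) := by rw [hE']; noncomm_ring
      _ = _ := by rw [hkh, mul_one]
  rw [← hgP, christoffel, Matrix.mul_apply, Finset.mul_sum]
  refine Finset.sum_congr rfl fun σ _ => ?_
  rw [hpd, hpd, hpd, hsw ν σ α, hsw α σ ν, hsw ν α σ]
  ring

/-- Second structure equation: the Riemann tensor from the curvature of the connection form. -/
theorem riemann_of_frame {A Ω : Fin 4 → Vec4 → Mat4} {B dΩ : Fin 4 → Fin 4 → Mat4}
    {E' : Fin 4 → Mat4}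
    (hΓ : ∀ᶠ y in 𝓝 x, ∀ μ ν α, christoffel g μ ν α y = (E y * (A α y + Ω α y * θ y)) μ ν)
    (hE : ∀ᶠ y in 𝓝 x, θ y * E y = 1) (hE' : ∀ μ, HasPdM μ E (E' μ) x)
    (hA : ∀ μ, HasPdM μ θ (A μ x) x) (hB : ∀ μ ν, HasPdM μ (A ν) (B μ ν) x)
    (hBsym : ∀ μ ν, B μ ν = B ν μ) (hΩ : ∀ μ ν, HasPdM μ (Ω ν) (dΩ μ ν) x)
    (μ ν α β : Fin 4) :
    riemann g μ ν α β x =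
      (E x * (dΩ α β - dΩ β α + Ω α x * Ω β x - Ω β x * Ω α x) * θ x) μ ν := by
  have hEx : θ x * E x = 1 := hE.self_of_nhds
  have hEx' : E x * θ x = 1 := mul_eq_one_comm.mp hEx
  -- Differentiating θ E = 1 fixes the derivative of the dual frame, so only its existence has to be
  -- known.
  have hdE : ∀ α, E' α = -(E x * A α x * E x) := by
    intro α
    have h1 := ((hA α).mul (hE' α)).congr (G := fun _ => (1 : Mat4)) (hE.mono fun y hy => hy.symm)
    have h2 := h1.unique (HasPdM.const 1)
    have h3 : E x * (A α x * E x + θ x * E' α) = E x * A α x * E x + (E x * θ x) * E' α := by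
      noncomm_ring
    rw [h2, hEx', mul_zero, one_mul] at h3
    exact eq_neg_of_add_eq_zero_right h3.symm
  set Γ : Fin 4 → Mat4 := fun α => E x * (A α x + Ω α x * θ x) with hΓdef
  have hdΓ : ∀ α β, HasPdM α (fun y => Matrix.of fun μ ν => christoffel g μ ν β y)
      (E x * (B α β + dΩ α β * θ x + Ω β x * A α x) - E x * A α x * Γ β) x := by
    intro α β
    have h1 := ((hE' α).mul ((hB α β).add ((hΩ α β).mul (hA α)))).congr
      (G := fun y => Matrix.of fun μ ν => christoffel g μ ν β y)
      (hΓ.mono fun y hy => by ext i j; simp [hy])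
    convert h1 using 1
    rw [hdE, hΓdef]
    noncomm_ring
  have hpd : ∀ α β μ ν, pd α (christoffel g μ ν β) x =
      (E x * (B α β + dΩ α β * θ x + Ω β x * A α x) - E x * A α x * Γ β) μ ν :=
    fun α β μ ν => (hdΓ α β μ ν).pd_eq
  have hΓx : ∀ μ ν α, christoffel g μ ν α x = Γ α μ ν := hΓ.self_of_nhds
  have hprod : ∀ α β, Γ α * Γ β = E x * A α x * Γ β + E x * Ω α x * (A β x + Ω β x * θ x) := by
    intro α β
    calc Γ α * Γ β = E x * A α x * Γ β + E x * Ω α x * (θ x * E x) * (A β x + Ω β x * θ x) := by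
          rw [hΓdef]; noncomm_ring
      _ = _ := by rw [hEx, mul_one]
  -- Passing from `Ω` to Γ is a gauge transformation by the frame, under which curvature is
  -- conjugated. The inhomogeneous terms cancel against the products, and the second derivatives of
  -- the frame cancel by their symmetry.
  have key : (E x * (B α β + dΩ α β * θ x + Ω β x * A α x) - E x * A α x * Γ β)
      - (E x * (B β α + dΩ β α * θ x + Ω α x * A β x) - E x * A β x * Γ α)
      + (Γ α * Γ β - Γ β * Γ α)
      = E x * (dΩ α β - dΩ β α + Ω α x * Ω β x - Ω β x * Ω α x) * θ x := by
    rw [hprod α β, hprod β α, hBsym α β]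
    noncomm_ring
  rw [← key, riemann, hpd, hpd]
  simp only [hΓx, Finset.sum_sub_distrib, ← Matrix.mul_apply, Matrix.sub_apply, Matrix.add_apply]

/-- The curvature of the connection form `∑ c, θ c μ • W c`, expanded in the frame `θ`. -/
theorem curvature_of_frame_components {θ : Mat4} {A W : Fin 4 → Mat4} {DW : Fin 4 → Fin 4 → Mat4}
    (htors : ∀ μ ν a, (A μ + (∑ c, θ c μ • W c) * θ) a ν = (A ν + (∑ c, θ c ν • W c) * θ) a μ)
    (α β : Fin 4) :
    (∑ c, (A α c β • W c + θ c β • ∑ d, θ d α • DW d c))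
      - (∑ c, (A β c α • W c + θ c α • ∑ d, θ d β • DW d c))
      + (∑ c, θ c α • W c) * (∑ c, θ c β • W c) - (∑ c, θ c β • W c) * (∑ c, θ c α • W c) =
    ∑ c, ∑ d, (θ c α * θ d β) • (DW c d - DW d c - (∑ e, (W c e d - W d e c) • W e)
      + W c * W d - W d * W c) := by
  -- Vanishing torsion expresses the exterior derivative of the e-th frame form through the
  -- antisymmetrized connection coefficients; this removes all derivatives of the frame.
  have h1 : ∀ e, A α e β - A β e α = -∑ c, ∑ d, (θ c α * θ d β) * (W c e d - W d e c) := by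
    intro e
    have h := htors α β e
    simp only [Matrix.add_apply, Matrix.mul_apply, Matrix.sum_apply, Matrix.smul_apply,
      smul_eq_mul, Finset.sum_mul] at h
    have h2 : A α e β - A β e α =
        (∑ d, ∑ c, θ d β * W d e c * θ c α) - ∑ c, ∑ d, θ c α * W c e d * θ d β := by linarith
    rw [h2, Finset.sum_comm, ← Finset.sum_sub_distrib, ← Finset.sum_neg_distrib]
    refine Finset.sum_congr rfl fun c _ => ?_
    rw [← Finset.sum_sub_distrib, ← Finset.sum_neg_distrib]
    exact Finset.sum_congr rfl fun d _ => by ring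
  have h2 : ∑ e, (A α e β - A β e α) • W e =
      -∑ c, ∑ d, (θ c α * θ d β) • ∑ e, (W c e d - W d e c) • W e := by
    simp only [h1, neg_smul, Finset.sum_neg_distrib, Finset.sum_smul, Finset.smul_sum, smul_smul]
    rw [Finset.sum_comm]
    congr 1
    refine Finset.sum_congr rfl fun c _ => ?_
    rw [Finset.sum_comm]
  have h3 : ∀ α β, (∑ c, θ c α • W c) * (∑ c, θ c β • W c) =
      ∑ c, ∑ d, (θ c α * θ d β) • (W c * W d) := by
    intro α β
    simp only [Finset.sum_mul, Finset.mul_sum, smul_mul_smul_comm]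
    exact Finset.sum_comm
  have h4 : ∀ α β, ∑ c, θ c β • ∑ d, θ d α • DW d c = ∑ c, ∑ d, (θ c α * θ d β) • DW c d := by
    intro α β
    simp only [Finset.smul_sum, smul_smul]
    rw [Finset.sum_comm]
    simp only [mul_comm]
  have h5 : ∀ F : Fin 4 → Fin 4 → Mat4, ∑ c, ∑ d, (θ c β * θ d α) • F c d =
      ∑ c, ∑ d, (θ c α * θ d β) • F d c := by
    intro F
    rw [Finset.sum_comm]
    simp only [mul_comm]
  simp only [smul_add, smul_sub, Finset.sum_add_distrib, Finset.sum_sub_distrib, h3, h4, h5]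
  simp only [sub_smul, Finset.sum_sub_distrib] at h2
  simp only [sub_smul, smul_sub, Finset.sum_sub_distrib] at h2 ⊢
  rw [← sub_eq_zero] at h2 ⊢
  rw [← h2]
  abel

end Frame

/-! ### Further derivative rules, and quadratic forms diagonal in a frame. -/

theorem HasPd.of_eq {μ : Fin 4} {f : Vec4 → ℝ} {f' g' : ℝ} {x : Vec4} (h : HasPd μ f f' x)
    (hv : f' = g') : HasPd μ f g' x := hv ▸ h

theorem HasPd.comp_coord {μ i : Fin 4} {φ : ℝ → ℝ} {φ' : ℝ} {x : Vec4}
    (h : HasDerivAt φ φ' (x i)) :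
    HasPd μ (fun z => φ (z i)) ((if i = μ then 1 else 0) * φ') x := by
  unfold HasPd
  by_cases hi : i = μ
  · subst hi
    simpa using h
  · simpa [hi] using hasDerivAt_const (x μ) (φ (x i))

theorem HasPd.inv {μ : Fin 4} {f : Vec4 → ℝ} {f' : ℝ} {x : Vec4} (hf : HasPd μ f f' x)
    (h0 : f x ≠ 0) : HasPd μ (fun y => (f y)⁻¹) (-f' / f x ^ 2) x := by
  have h := HasDerivAt.inv hf (by simpa using h0)
  simp only [Function.update_eq_self] at h
  exact h

theorem eval2_eq_dotProduct (A : Mat4) (u v : Vec4) : eval2 A u v = u ⬝ᵥ A *ᵥ v := by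
  simp only [eval2, dotProduct, Matrix.mulVec, Finset.mul_sum]
  exact Finset.sum_congr rfl fun i _ => Finset.sum_congr rfl fun j _ => by ring

theorem eval2_diagonal_frame (d : Fin 4 → ℝ) (C : Mat4) (u v : Vec4) :
    eval2 (Cᵀ * Matrix.diagonal d * C) u v = ∑ α, d α * (C *ᵥ u) α * (C *ᵥ v) α := by
  rw [eval2_eq_dotProduct, ← Matrix.mulVec_mulVec, ← Matrix.mulVec_mulVec,
    Matrix.dotProduct_mulVec, Matrix.vecMul_transpose, dotProduct]
  exact Finset.sum_congr rfl fun α _ => by rw [Matrix.mulVec_diagonal]; ring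

end LorentzChart

noncomputable section

namespace EyeOfStorm

/-! ### Connection and curvature as rational functions of a jet. -/

/-- The values `a, r, y = cos θ` together with those of `Δ` and its first two derivatives. -/
structure Jet where
  a : ℝ
  r : ℝ
  y : ℝ
  D : ℝ
  D1 : ℝ
  D2 : ℝ

namespace Jet

/-- `Σ` as a function of the jet. -/
def S (p : Jet) : ℝ := p.r ^ 2 + p.a ^ 2 * p.y ^ 2

/-- `sin² θ` as a function of the jet. -/
def U (p : Jet) : ℝ := 1 - p.y ^ 2

end Jet

/-- Polynomial terms in `a`, `r`, `y = cos θ`, `Δ`, `Δ'`, `1/Σ`, `1/Δ` and `1/sin² θ`. -/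
inductive Term
  | num (c : ℝ)
  | a
  | r
  | y
  | D
  | D1
  | invS
  | invD
  | invU
  | add (s t : Term)
  | mul (s t : Term)

namespace Term

instance : Add Term := ⟨add⟩
instance : Mul Term := ⟨mul⟩
instance : Neg Term := ⟨mul (num (-1))⟩
instance : Zero Term := ⟨num 0⟩

/-- The term `sin² θ = 1 - y²`. -/
def U : Term := num 1 + -(y * y)

/-- The value of a term. -/
def eval (p : Jet) : Term → ℝ
  | num c => c
  | a => p.a
  | r => p.r
  | y => p.y
  | D => p.D
  | D1 => p.D1
  | invS => p.S⁻¹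
  | invD => p.D⁻¹
  | invU => p.U⁻¹
  | add s t => s.eval p + t.eval p
  | mul s t => s.eval p * t.eval p

/-- The value of the derivative of a term with respect to `r`. -/
def evalR (p : Jet) : Term → ℝ
  | num _ => 0
  | a => 0
  | r => 1
  | y => 0
  | D => p.D1
  | D1 => p.D2
  | invS => -(2 * p.r) / p.S ^ 2
  | invD => -p.D1 / p.D ^ 2
  | invU => 0
  | add s t => s.evalR p + t.evalR p
  | mul s t => s.evalR p * t.eval p + s.eval p * t.evalR p

/-- The value of the derivative of a term with respect to `y = cos θ`. -/
def evalY (p : Jet) : Term → ℝ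
  | num _ => 0
  | a => 0
  | r => 0
  | y => 1
  | D => 0
  | D1 => 0
  | invS => -(2 * p.a ^ 2 * p.y) / p.S ^ 2
  | invD => 0
  | invU => 2 * p.y / p.U ^ 2
  | add s t => s.evalY p + t.evalY p
  | mul s t => s.evalY p * t.eval p + s.eval p * t.evalY p

variable (p : Jet) (s t : Term)

@[simp] theorem eval_num (c : ℝ) : (num c).eval p = c := rfl
@[simp] theorem eval_a : a.eval p = p.a := rfl
@[simp] theorem eval_r : r.eval p = p.r := rfl
@[simp] theorem eval_y : y.eval p = p.y := rfl
@[simp] theorem eval_D : D.eval p = p.D := rfl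
@[simp] theorem eval_D1 : D1.eval p = p.D1 := rfl
@[simp] theorem eval_invS : invS.eval p = p.S⁻¹ := rfl
@[simp] theorem eval_invD : invD.eval p = p.D⁻¹ := rfl
@[simp] theorem eval_invU : invU.eval p = p.U⁻¹ := rfl
@[simp] theorem eval_zero : (0 : Term).eval p = 0 := rfl
@[simp] theorem eval_add : (s + t).eval p = s.eval p + t.eval p := rfl
@[simp] theorem eval_mul : (s * t).eval p = s.eval p * t.eval p := rfl
@[simp] theorem eval_neg : (-t).eval p = -t.eval p := neg_one_mul _
@[simp] theorem eval_U : U.eval p = p.U := by simp [U, Jet.U]; ring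

@[simp] theorem evalR_num (c : ℝ) : (num c).evalR p = 0 := rfl
@[simp] theorem evalR_a : a.evalR p = 0 := rfl
@[simp] theorem evalR_r : r.evalR p = 1 := rfl
@[simp] theorem evalR_y : y.evalR p = 0 := rfl
@[simp] theorem evalR_D : D.evalR p = p.D1 := rfl
@[simp] theorem evalR_D1 : D1.evalR p = p.D2 := rfl
@[simp] theorem evalR_invS : invS.evalR p = -(2 * p.r) / p.S ^ 2 := rfl
@[simp] theorem evalR_invD : invD.evalR p = -p.D1 / p.D ^ 2 := rfl
@[simp] theorem evalR_invU : invU.evalR p = 0 := rfl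
@[simp] theorem evalR_zero : (0 : Term).evalR p = 0 := rfl
@[simp] theorem evalR_add : (s + t).evalR p = s.evalR p + t.evalR p := rfl
@[simp] theorem evalR_mul : (s * t).evalR p = s.evalR p * t.eval p + s.eval p * t.evalR p := rfl
@[simp] theorem evalR_neg : (-t).evalR p = -t.evalR p := by
  change 0 * _ + (-1) * _ = _
  ring
@[simp] theorem evalR_U : U.evalR p = 0 := by simp [U]

@[simp] theorem evalY_num (c : ℝ) : (num c).evalY p = 0 := rfl
@[simp] theorem evalY_a : a.evalY p = 0 := rfl
@[simp] theorem evalY_r : r.evalY p = 0 := rfl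
@[simp] theorem evalY_y : y.evalY p = 1 := rfl
@[simp] theorem evalY_D : D.evalY p = 0 := rfl
@[simp] theorem evalY_D1 : D1.evalY p = 0 := rfl
@[simp] theorem evalY_invS : invS.evalY p = -(2 * p.a ^ 2 * p.y) / p.S ^ 2 := rfl
@[simp] theorem evalY_invD : invD.evalY p = 0 := rfl
@[simp] theorem evalY_invU : invU.evalY p = 2 * p.y / p.U ^ 2 := rfl
@[simp] theorem evalY_zero : (0 : Term).evalY p = 0 := rfl
@[simp] theorem evalY_add : (s + t).evalY p = s.evalY p + t.evalY p := rfl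
@[simp] theorem evalY_mul : (s * t).evalY p = s.evalY p * t.eval p + s.eval p * t.evalY p := rfl
@[simp] theorem evalY_neg : (-t).evalY p = -t.evalY p := by
  change 0 * _ + (-1) * _ = _
  ring
@[simp] theorem evalY_U : U.evalY p = -(2 * p.y) := by simp [U]; ring

end Term

/-- Derivative of a matrix of terms along the `c`-th vector of the frame dual to
`dt - a sin² θ dφ, dr, d cos θ, (r² + a²) dφ - a dt`. -/
def frameDeriv (p : Jet) : Fin 4 → Matrix (Fin 4) (Fin 4) Term → Mat4
  | 0, _ => 0
  | 1, F => F.map (Term.evalR p)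
  | 2, F => F.map (Term.evalY p)
  | 3, _ => 0

open Term in
/-- The matrix of the metric in the frame
`dt - a sin² θ dφ, dr, d cos θ, (r² + a²) dφ - a dt`. -/
def hTerm : Matrix (Fin 4) (Fin 4) Term :=
  !![-(D * invS), 0, 0, 0;
     0, (r * r + a * a * (y * y)) * invD, 0, 0;
     0, 0, (r * r + a * a * (y * y)) * invU, 0;
     0, 0, 0, U * invS]

open Term in
/-- The logarithmic derivative `∂_r log |h₀| / 2` of the first diagonal entry of `hTerm`. -/
def dlogR : Term := num (1 / 2) * D1 * invD + -(r * invS)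

open Term in
/-- The logarithmic derivative `-∂_y log |h₀| / 2` of the first diagonal entry of `hTerm`. -/
def dlogY : Term := a * a * y * invS

open Term in
/-- The connection form of the metric in the frame
`dt - a sin² θ dφ, dr, d cos θ, (r² + a²) dφ - a dt`; the index is that of the form. -/
def connTerm : Fin 4 → Matrix (Fin 4) (Fin 4) Term
  | 0 => !![0, dlogR, dlogY, 0;
       dlogR * (D * D) * (invS * invS), 0, 0, -(U * D * r * a * (invS * (invS * invS)));
       dlogY * D * U * (invS * invS), 0, 0, a * y * D * U * (invS * (invS * invS));
       0, r * a * invS, -(D * invU * a * y * invS), 0]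
  | 1 => !![dlogR, 0, 0, -(U * invD * r * a * invS);
       0, -dlogR, dlogY, 0;
       0, -(U * invD * dlogY), r * invS, 0;
       -(r * a * invS), 0, 0, -(r * invS)]
  | 2 => !![-dlogY, 0, 0, -(a * y * invS);
       0, dlogY, -(r * invS * D * invU), 0;
       0, r * invS, dlogY + y * invU, 0;
       -(D * invU * a * y * invS), 0, 0, -(dlogY + y * invU)]
  | 3 => !![0, -(U * invD * r * a * invS), a * y * invS, 0;
       -(U * D * r * a * (invS * (invS * invS))), 0, 0, -(U * D * r * (invS * (invS * invS)));
       D * U * a * y * (invS * (invS * invS)), 0, 0, (dlogY * U + y) * U * (invS * invS);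
       0, r * invS, -(dlogY + y * invU), 0]

/-- The value of the connection form. -/
def conn (p : Jet) (c : Fin 4) : Mat4 := (connTerm c).map (Term.eval p)

/-- The value of the metric in the frame. -/
def hMat (p : Jet) : Mat4 := hTerm.map (Term.eval p)

/-- The curvature of the connection form in the frame. -/
def curvature (p : Jet) (c d : Fin 4) : Mat4 :=
  frameDeriv p c (connTerm d) - frameDeriv p d (connTerm c)
    - (∑ e, (conn p c e d - conn p d e c) • conn p e)
    + conn p c * conn p d - conn p d * conn p c

/-- Metric compatibility of `connTerm`. It holds identically in the jet, so it does not depend on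
which function of r is taken for Δ. -/
theorem frameDeriv_hTerm {p : Jet} (hS : p.S ≠ 0) (hU : p.U ≠ 0) (hD : p.D ≠ 0) (c : Fin 4) :
    frameDeriv p c hTerm = hMat p * conn p c + (conn p c)ᵀ * hMat p := by
  have e1 : p.U = 1 - p.y ^ 2 := rfl
  have e2 : p.S = p.r ^ 2 + p.a ^ 2 * p.y ^ 2 := rfl
  ext i j
  fin_cases c <;> fin_cases i <;> fin_cases j <;>
    simp [frameDeriv, hTerm, hMat, conn, connTerm, Matrix.mul_apply, Fin.sum_univ_four, dlogR,
      dlogY] <;>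
    field_simp <;> (try simp only [e1, e2]) <;> ring

/-- The structure functions of the frame: `structureFn p e c d` is the `e`-component of the
commutator of the `c`-th and `d`-th vector of the frame. -/
def structureFn (p : Jet) : Fin 4 → Mat4
  | 0 => !![0, 0, 2 * p.a ^ 2 * p.y / p.S, 0;
            0, 0, 0, 0;
            -(2 * p.a ^ 2 * p.y / p.S), 0, 0, -(2 * p.a * p.y / p.S);
            0, 0, 2 * p.a * p.y / p.S, 0]
  | 1 => 0
  | 2 => 0
  | 3 => !![0, 2 * p.r * p.a / p.S, 0, 0;
            -(2 * p.r * p.a / p.S), 0, 0, -(2 * p.r / p.S);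
            0, 0, 0, 0;
            0, 2 * p.r / p.S, 0, 0]

/-- This is the frame version of vanishing torsion. The commutators know nothing of the metric, so
every Δ and 1/sin²θ in the connection must cancel here. The components 1 and 2 are zero because dr
and d cos θ are closed. -/
theorem conn_sub_conn {p : Jet} (hS : p.S ≠ 0) (e c d : Fin 4) :
    conn p c e d - conn p d e c = structureFn p e c d := by
  have e1 : p.U = 1 - p.y ^ 2 := rfl
  have e2 : p.S = p.r ^ 2 + p.a ^ 2 * p.y ^ 2 := rfl
  fin_cases e <;> fin_cases c <;> fin_cases d <;>
    simp [conn, connTerm, dlogR, dlogY, structureFn] <;>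
    field_simp <;> (try simp only [e1, e2]) <;> ring

/-- The component `R^{01}_{01}`. -/
def Jet.kA (p : Jet) : ℝ :=
  -(p.D2 - 2) / (2 * p.S) + 2 * (p.r * (p.D1 - 2 * p.r) - (p.D - p.r ^ 2 - p.a ^ 2)) / p.S ^ 2
    - (p.D - p.r ^ 2 - p.a ^ 2) * (p.r ^ 2 - 3 * p.a ^ 2 * p.y ^ 2) / p.S ^ 3

/-- The component `R^{23}_{23}`. -/
def Jet.kB (p : Jet) : ℝ :=
  -((p.D - p.r ^ 2 - p.a ^ 2) * (p.r ^ 2 - 3 * p.a ^ 2 * p.y ^ 2) / p.S ^ 3)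

/-- The components `R^{02}_{02} = R^{03}_{03} = R^{12}_{12} = R^{13}_{13}`. -/
def Jet.kC (p : Jet) : ℝ :=
  -(p.r * (p.D1 - 2 * p.r) - (p.D - p.r ^ 2 - p.a ^ 2)) / (2 * p.S ^ 2)
    + (p.D - p.r ^ 2 - p.a ^ 2) * (p.r ^ 2 - 3 * p.a ^ 2 * p.y ^ 2) / (2 * p.S ^ 3)

/-- Minus one half of the component `R^{01}_{23}`. -/
def Jet.kD (p : Jet) : ℝ :=
  p.a * p.y * (-(p.D1 - 2 * p.r) / (2 * p.S ^ 2)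
    + 2 * (p.D - p.r ^ 2 - p.a ^ 2) * p.r / p.S ^ 3)

/-- Inserting the structure functions before expanding shortens the sum, since two of the four
matrices vanish. -/
theorem curvature_eq {p : Jet} (hS : p.S ≠ 0) (c d : Fin 4) :
    curvature p c d = frameDeriv p c (connTerm d) - frameDeriv p d (connTerm c)
    - (∑ e, structureFn p e c d • conn p e)
    + conn p c * conn p d - conn p d * conn p c := by
  simp only [curvature, conn_sub_conn hS]

/-- In this and the following five lemmas each entry is written, up to sign, with the reciprocal of
the entry of `hInv` for its column as a factor, so that raising the second index leaves an
antisymmetric matrix. These six pairs suffice by `curvature_swap` and `curvature_self`. -/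
theorem curvature_zero_one {p : Jet} (hS : p.S ≠ 0) (hU : p.U ≠ 0) (hD : p.D ≠ 0) :
    curvature p 0 1 =
      !![0, p.S / p.D * p.kA, 0, 0;
         p.D / p.S * p.kA, 0, 0, 0;
         0, 0, 0, p.U / p.S * (2 * p.kD);
         0, 0, -(p.S / p.U * (2 * p.kD)), 0] := by
  have e1 : p.U = 1 - p.y ^ 2 := rfl
  have e2 : p.S = p.r ^ 2 + p.a ^ 2 * p.y ^ 2 := rfl
  rw [curvature_eq hS]
  ext i j
  fin_cases i <;> fin_cases j <;>
    simp [frameDeriv, conn, connTerm, Matrix.mul_apply, Fin.sum_univ_four, dlogR, dlogY,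
      structureFn, Jet.kA, Jet.kD] <;>
    field_simp <;> (try simp only [e1, e2]) <;> ring

theorem curvature_two_three {p : Jet} (hS : p.S ≠ 0) (hU : p.U ≠ 0) (hD : p.D ≠ 0) :
    curvature p 2 3 =
      !![0, p.S / p.D * (-2 * p.kD), 0, 0;
         p.D / p.S * (-2 * p.kD), 0, 0, 0;
         0, 0, 0, p.U / p.S * p.kB;
         0, 0, -(p.S / p.U * p.kB), 0] := by
  have e1 : p.U = 1 - p.y ^ 2 := rfl
  have e2 : p.S = p.r ^ 2 + p.a ^ 2 * p.y ^ 2 := rfl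
  rw [curvature_eq hS]
  ext i j
  fin_cases i <;> fin_cases j <;>
    simp [frameDeriv, conn, connTerm, Matrix.mul_apply, Fin.sum_univ_four, dlogR, dlogY,
      structureFn, Jet.kB, Jet.kD] <;>
    field_simp <;> (try simp only [e1, e2]) <;> ring

theorem curvature_zero_two {p : Jet} (hS : p.S ≠ 0) (hU : p.U ≠ 0) (hD : p.D ≠ 0) :
    curvature p 0 2 =
      !![0, 0, p.S / p.U * p.kC, 0;
         0, 0, 0, p.U / p.S * (p.kD * p.D / p.U);
         p.D / p.S * p.kC, 0, 0, 0;
         0, -(p.S / p.D * (p.kD * p.D / p.U)), 0, 0] := by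
  have e1 : p.U = 1 - p.y ^ 2 := rfl
  have e2 : p.S = p.r ^ 2 + p.a ^ 2 * p.y ^ 2 := rfl
  rw [curvature_eq hS]
  ext i j
  fin_cases i <;> fin_cases j <;>
    simp [frameDeriv, conn, connTerm, Matrix.mul_apply, Fin.sum_univ_four, dlogR, dlogY,
      structureFn, Jet.kC, Jet.kD] <;>
    field_simp <;> (try simp only [e1, e2]) <;> ring

theorem curvature_one_three {p : Jet} (hS : p.S ≠ 0) (hU : p.U ≠ 0) (hD : p.D ≠ 0) :
    curvature p 1 3 =
      !![0, 0, p.S / p.U * (-(p.kD * p.U / p.D)), 0;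
         0, 0, 0, p.U / p.S * p.kC;
         p.D / p.S * (-(p.kD * p.U / p.D)), 0, 0, 0;
         0, -(p.S / p.D * p.kC), 0, 0] := by
  have e1 : p.U = 1 - p.y ^ 2 := rfl
  have e2 : p.S = p.r ^ 2 + p.a ^ 2 * p.y ^ 2 := rfl
  rw [curvature_eq hS]
  ext i j
  fin_cases i <;> fin_cases j <;>
    simp [frameDeriv, conn, connTerm, Matrix.mul_apply, Fin.sum_univ_four, dlogR, dlogY,
      structureFn, Jet.kC, Jet.kD] <;>
    field_simp <;> (try simp only [e1, e2]) <;> ring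

theorem curvature_zero_three {p : Jet} (hS : p.S ≠ 0) (hU : p.U ≠ 0) (hD : p.D ≠ 0) :
    curvature p 0 3 =
      !![0, 0, 0, p.U / p.S * p.kC;
         0, 0, p.S / p.U * (-(p.kD * p.D * p.U / p.S ^ 2)), 0;
         0, -(p.S / p.D * (-(p.kD * p.D * p.U / p.S ^ 2))), 0, 0;
         p.D / p.S * p.kC, 0, 0, 0] := by
  have e1 : p.U = 1 - p.y ^ 2 := rfl
  have e2 : p.S = p.r ^ 2 + p.a ^ 2 * p.y ^ 2 := rfl
  rw [curvature_eq hS]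
  ext i j
  fin_cases i <;> fin_cases j <;>
    simp [frameDeriv, conn, connTerm, Matrix.mul_apply, Fin.sum_univ_four, dlogR, dlogY,
      structureFn, Jet.kC, Jet.kD] <;>
    field_simp <;> (try simp only [e1, e2]) <;> ring

theorem curvature_one_two {p : Jet} (hS : p.S ≠ 0) (hU : p.U ≠ 0) (hD : p.D ≠ 0) :
    curvature p 1 2 =
      !![0, 0, 0, p.U / p.S * (p.kD * p.S ^ 2 / (p.D * p.U));
         0, 0, p.S / p.U * p.kC, 0;
         0, -(p.S / p.D * p.kC), 0, 0;
         p.D / p.S * (p.kD * p.S ^ 2 / (p.D * p.U)), 0, 0, 0] := by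
  have e1 : p.U = 1 - p.y ^ 2 := rfl
  have e2 : p.S = p.r ^ 2 + p.a ^ 2 * p.y ^ 2 := rfl
  rw [curvature_eq hS]
  ext i j
  fin_cases i <;> fin_cases j <;>
    simp [frameDeriv, conn, connTerm, Matrix.mul_apply, Fin.sum_univ_four, dlogR, dlogY,
      structureFn, Jet.kC, Jet.kD] <;>
    field_simp <;> (try simp only [e1, e2]) <;> ring

/-! ### The frame of the eye of the storm metric and its derivatives. -/

variable {m a ℓ : ℝ} {x : Vec4}

/-- The jet of the eye of the storm metric at a point. -/
def jet (m a ℓ : ℝ) (x : Vec4) : Jet where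
  a := a
  r := x 1
  y := cos (x 2)
  D := Del m a ℓ x
  D1 := 2 * x 1 - 2 * m * (1 + ℓ / x 1) * exp (-ℓ / x 1)
  D2 := 2 - 2 * m * (ℓ ^ 2 / x 1 ^ 3) * exp (-ℓ / x 1)

/-- The frame of one-forms `dt - a sin² θ dφ, dr, d cos θ, (r² + a²) dφ - a dt` (rows). -/
def frame (a : ℝ) (x : Vec4) : Mat4 :=
  !![1, 0, 0, -(a * sin (x 2) ^ 2);
     0, 1, 0, 0;
     0, 0, -sin (x 2), 0;
     -a, 0, 0, x 1 ^ 2 + a ^ 2]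

/-- The dual frame of vectors (columns). -/
def dualFrame (a : ℝ) (x : Vec4) : Mat4 :=
  !![(x 1 ^ 2 + a ^ 2) * (Sig a x)⁻¹, 0, 0, a * sin (x 2) ^ 2 * (Sig a x)⁻¹;
     0, 1, 0, 0;
     0, 0, -(sin (x 2))⁻¹, 0;
     a * (Sig a x)⁻¹, 0, 0, (Sig a x)⁻¹]

/-- The partial derivatives of `frame`. -/
def frameD (a : ℝ) : Fin 4 → Vec4 → Mat4
  | 0, _ => 0
  | 1, x => !![0, 0, 0, 0; 0, 0, 0, 0; 0, 0, 0, 0; 0, 0, 0, 2 * x 1]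
  | 2, x => !![0, 0, 0, -(a * (2 * sin (x 2) * cos (x 2))); 0, 0, 0, 0;
               0, 0, -cos (x 2), 0; 0, 0, 0, 0]
  | 3, _ => 0

/-- The second partial derivatives of `frame`. -/
def frameDD (a : ℝ) : Fin 4 → Fin 4 → Vec4 → Mat4
  | 1, 1, _ => !![0, 0, 0, 0; 0, 0, 0, 0; 0, 0, 0, 0; 0, 0, 0, 2]
  | 2, 2, x => !![0, 0, 0, -(a * (2 * (cos (x 2) ^ 2 - sin (x 2) ^ 2))); 0, 0, 0, 0;
                  0, 0, sin (x 2), 0; 0, 0, 0, 0]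
  | _, _, _ => 0

theorem hasDerivAt_sin_sq (t : ℝ) :
    HasDerivAt (fun t => -(a * sin t ^ 2)) (-(a * (2 * sin t * cos t))) t := by
  have h := (((hasDerivAt_sin t).pow 2).const_mul a).neg
  simp only [Nat.cast_ofNat, Nat.add_one_sub_one, pow_one] at h
  exact h

theorem hasDerivAt_sin_mul_cos (t : ℝ) :
    HasDerivAt (fun t => -(a * (2 * sin t * cos t))) (-(a * (2 * (cos t ^ 2 - sin t ^ 2)))) t := by
  have h := ((((hasDerivAt_sin t).const_mul 2).mul (hasDerivAt_cos t)).const_mul a).neg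
  exact h.congr_deriv (by ring)

theorem hasDerivAt_sq_add (t : ℝ) : HasDerivAt (fun t => t ^ 2 + a ^ 2) (2 * t) t := by
  simpa using (hasDerivAt_pow 2 t).add_const (a ^ 2)

theorem hasPdM_frame (μ : Fin 4) : HasPdM μ (frame a) (frameD a μ x) x := by
  intro i j
  have hc : (∀ z, frame a z i j = frame a x i j) → frameD a μ x i j = 0 →
      HasPd μ (fun z => frame a z i j) (frameD a μ x i j) x := by
    intro h1 h2
    simpa only [h1, h2] using HasPd.const _
  fin_cases i <;> fin_cases j
  -- The sixteen entries are numbered row by row. The nonconstant ones are taken from the last to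
  -- the first, so that the remaining numbers stay valid.
  pick_goal 16
  · exact (HasPd.comp_coord (μ := μ) (i := 1) (x := x) (hasDerivAt_sq_add (a := a) (x 1))).of_eq
      (by fin_cases μ <;> simp [frameD])
  pick_goal 11
  · exact (HasPd.comp_coord (μ := μ) (i := 2) (x := x) (hasDerivAt_sin (x 2)).neg).of_eq
      (by fin_cases μ <;> simp [frameD])
  pick_goal 4
  · exact (HasPd.comp_coord (μ := μ) (i := 2) (x := x) (hasDerivAt_sin_sq (a := a) (x 2))).of_eq
      (by fin_cases μ <;> simp [frameD])
  all_goals exact hc (fun _ => by simp [frame]) (by fin_cases μ <;> rfl)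

theorem hasPdM_frameD (μ ν : Fin 4) : HasPdM μ (frameD a ν) (frameDD a μ ν x) x := by
  intro i j
  have hc : (∀ z, frameD a ν z i j = 0) → frameDD a μ ν x i j = 0 →
      HasPd μ (fun z => frameD a ν z i j) (frameDD a μ ν x i j) x := by
    intro h1 h2
    simpa only [h1, h2] using HasPd.const _
  fin_cases ν <;> fin_cases i <;> fin_cases j
  -- There are sixteen goals for each ν: numbers 43 and 36 are entries (2,2) and (0,3) for ν = 2,
  -- and 32 is entry (3,3) for ν = 1.
  pick_goal 43
  · exact (HasPd.comp_coord (μ := μ) (i := 2) (x := x) (hasDerivAt_cos (x 2)).neg).of_eq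
      (by fin_cases μ <;> simp [frameDD])
  pick_goal 36
  · exact (HasPd.comp_coord (μ := μ) (i := 2) (x := x)
      (hasDerivAt_sin_mul_cos (a := a) (x 2))).of_eq (by fin_cases μ <;> simp [frameDD])
  pick_goal 32
  · exact (HasPd.comp_coord (μ := μ) (i := 1) (x := x)
      ((hasDerivAt_id (x 1)).const_mul 2)).of_eq (by fin_cases μ <;> simp [frameDD])
  all_goals exact hc (fun _ => rfl) (by fin_cases μ <;> rfl)

theorem frameDD_comm (μ ν : Fin 4) : frameDD a μ ν x = frameDD a ν μ x := by
  fin_cases μ <;> fin_cases ν <;> rfl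

theorem Sig_pos (hr : 0 < x 1) : 0 < Sig a x := by
  unfold Sig
  positivity

theorem sin_pos_of_chart (hx : x ∈ chart m a ℓ) : 0 < sin (x 2) :=
  sin_pos_of_pos_of_lt_pi hx.2.1 hx.2.2.1

theorem jet_S : (jet m a ℓ x).S = Sig a x := rfl

theorem jet_U : (jet m a ℓ x).U = sin (x 2) ^ 2 := by
  rw [sin_sq]
  rfl

theorem jet_S_ne (hx : x ∈ chart m a ℓ) : (jet m a ℓ x).S ≠ 0 := (Sig_pos hx.1).ne'

theorem jet_U_ne (hx : x ∈ chart m a ℓ) : (jet m a ℓ x).U ≠ 0 := by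
  rw [jet_U]
  exact pow_ne_zero 2 (sin_pos_of_chart hx).ne'

theorem jet_D_ne (hx : x ∈ chart m a ℓ) : (jet m a ℓ x).D ≠ 0 := hx.2.2.2

theorem frame_mul_dualFrame (hx : x ∈ chart m a ℓ) : frame a x * dualFrame a x = 1 := by
  have hS := (Sig_pos (a := a) hx.1).ne'
  have hs := (sin_pos_of_chart hx).ne'
  have h2 : Sig a x = x 1 ^ 2 + a ^ 2 * (1 - sin (x 2) ^ 2) := by rw [Sig, cos_sq']
  ext i j
  fin_cases i <;> fin_cases j <;>
    simp [frame, dualFrame, Matrix.mul_apply, Fin.sum_univ_four] <;>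
    field_simp <;> (try rw [h2]) <;> ring

theorem metric_eq_frame (hx : x ∈ chart m a ℓ) :
    metric m a ℓ x = (frame a x)ᵀ * hMat (jet m a ℓ x) * frame a x := by
  have hS := (Sig_pos (a := a) hx.1).ne'
  have hs := (sin_pos_of_chart hx).ne'
  have hD := hx.2.2.2
  have hU := jet_U (m := m) (a := a) (ℓ := ℓ) (x := x)
  have h1 : (jet m a ℓ x).r * (jet m a ℓ x).r +
    (jet m a ℓ x).a * (jet m a ℓ x).a * ((jet m a ℓ x).y * (jet m a ℓ x).y) = Sig a x := by
    simp [Sig, jet]; ring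
  have h2 : (jet m a ℓ x).D = Del m a ℓ x := rfl
  ext i j
  fin_cases i <;> fin_cases j <;>
    simp [metric, frame, hMat, hTerm, Matrix.mul_apply, Fin.sum_univ_four, formR, formT, formTheta,
      formPhi, jet_S, hU, h1, h2] <;>
    field_simp

theorem hasDerivAt_exp_neg_div {r : ℝ} (hr : r ≠ 0) :
    HasDerivAt (fun r => exp (-ℓ / r)) (exp (-ℓ / r) * (ℓ / r ^ 2)) r := by
  have h := (((hasDerivAt_const r (-ℓ)).fun_div (hasDerivAt_id' r) hr).exp)
  exact h.congr_deriv (by simp)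

theorem hasDerivAt_Del {r : ℝ} (hr : r ≠ 0) :
    HasDerivAt (fun r => r ^ 2 + a ^ 2 - 2 * m * r * exp (-ℓ / r))
      (2 * r - 2 * m * (1 + ℓ / r) * exp (-ℓ / r)) r := by
  have h := (hasDerivAt_sq_add (a := a) r).sub
    (((hasDerivAt_id' r).const_mul (2 * m)).mul (hasDerivAt_exp_neg_div (ℓ := ℓ) hr))
  exact h.congr_deriv (by field_simp)

theorem hasDerivAt_deriv_Del {r : ℝ} (hr : r ≠ 0) :
    HasDerivAt (fun r => 2 * r - 2 * m * (1 + ℓ / r) * exp (-ℓ / r))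
      (2 - 2 * m * (ℓ ^ 2 / r ^ 3) * exp (-ℓ / r)) r := by
  have h0 := ((hasDerivAt_const r ℓ).fun_div (hasDerivAt_id' r) hr).const_add 1
  have h := ((hasDerivAt_id' r).const_mul 2).sub
    ((h0.const_mul (2 * m)).mul (hasDerivAt_exp_neg_div (ℓ := ℓ) hr))
  exact h.congr_deriv (by field_simp; ring)

/-- The chart is open. The structure equations differentiate identities, which must therefore hold
near the point and not only at it. -/
theorem eventually_mem_chart (hx : x ∈ chart m a ℓ) : ∀ᶠ z in 𝓝 x, z ∈ chart m a ℓ := by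
  have c1 : ContinuousAt (fun z : Vec4 => z 1) x := (continuous_apply 1).continuousAt
  have c2 : ContinuousAt (fun z : Vec4 => z 2) x := (continuous_apply 2).continuousAt
  have c3 : ContinuousAt (Del m a ℓ) x :=
    ContinuousAt.comp (f := fun z : Vec4 => z 1) (hasDerivAt_Del hx.1.ne').continuousAt c1
  exact (c1.eventually_const_lt hx.1).and ((c2.eventually_const_lt hx.2.1).and
    ((c2.eventually_lt_const hx.2.2.1).and (c3.eventually_ne hx.2.2.2)))

/-- The chain rule through r and y = cos θ, whose differentials are rows 1 and 2 of the frame. This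
ties the formal derivatives of terms to actual partial derivatives; `D2` enters only as the
derivative of `D1`, so it needs no term of its own. -/
theorem hasPd_eval (hx : x ∈ chart m a ℓ) (μ : Fin 4) (t : Term) :
    HasPd μ (fun z => t.eval (jet m a ℓ z))
      (frame a x 1 μ * t.evalR (jet m a ℓ x) + frame a x 2 μ * t.evalY (jet m a ℓ x)) x := by
  have f1 : frame a x 1 μ = if (1 : Fin 4) = μ then 1 else 0 := by
    fin_cases μ <;> simp [frame]
  have f2 : frame a x 2 μ = (if (2 : Fin 4) = μ then 1 else 0) * -sin (x 2) := by
    fin_cases μ <;> simp [frame]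
  have hr0 := hx.1.ne'
  have hr : HasPd μ (fun z : Vec4 => z 1) (frame a x 1 μ) x := by
    rw [f1]
    simpa using HasPd.comp_coord (μ := μ) (x := x) (hasDerivAt_id (x 1))
  have hy : HasPd μ (fun z : Vec4 => cos (z 2)) (frame a x 2 μ) x := by
    rw [f2]
    exact HasPd.comp_coord (μ := μ) (x := x) (hasDerivAt_cos (x 2))
  have hD : HasPd μ (fun z => (jet m a ℓ z).D) (frame a x 1 μ * (jet m a ℓ x).D1) x := by
    rw [f1]
    exact HasPd.comp_coord (μ := μ) (x := x) (hasDerivAt_Del hr0)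
  have hS : HasPd μ (fun z => (jet m a ℓ z).S)
      (frame a x 1 μ * (2 * (jet m a ℓ x).r)
        + frame a x 2 μ * (2 * (jet m a ℓ x).a ^ 2 * (jet m a ℓ x).y)) x := by
    have h := (hr.mul hr).add ((HasPd.const (a ^ 2)).mul (hy.mul hy))
    convert h using 1
    · ext z
      simp [jet, Jet.S]
      ring
    · simp [jet]
      ring
  have hU : HasPd μ (fun z => (jet m a ℓ z).U)
      (frame a x 2 μ * (-2 * (jet m a ℓ x).y)) x := by
    have h := (HasPd.const 1).add ((HasPd.const (-1)).mul (hy.mul hy))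
    convert h using 1
    · ext z
      simp [jet, Jet.U]
      ring
    · simp [jet]
      ring
  induction t with
  | num c => exact (HasPd.const c).of_eq (by simp)
  | a => exact (HasPd.const a).of_eq (by simp)
  | r => exact hr.of_eq (by simp)
  | y => exact hy.of_eq (by simp)
  | D => exact hD.of_eq (by simp)
  | D1 =>
    exact (HasPd.comp_coord (μ := μ) (x := x) (hasDerivAt_deriv_Del hr0)).of_eq
      (by simp [f1, jet])
  | invS => exact (hS.inv (jet_S_ne hx)).of_eq (by simp only [Term.evalR, Term.evalY]; ring)
  | invD => exact (hD.inv (jet_D_ne hx)).of_eq (by simp only [Term.evalR, Term.evalY]; ring)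
  | invU => exact (hU.inv (jet_U_ne hx)).of_eq (by simp only [Term.evalR, Term.evalY]; ring)
  | add s t hs ht => exact (hs.add ht).of_eq (by simp only [Term.evalR, Term.evalY]; ring)
  | mul s t hs ht => exact (hs.mul ht).of_eq (by simp only [Term.evalR, Term.evalY]; ring)

theorem hasPdM_eval (hx : x ∈ chart m a ℓ) (μ : Fin 4) (F : Matrix (Fin 4) (Fin 4) Term) :
    HasPdM μ (fun z => F.map (Term.eval (jet m a ℓ z)))
      (∑ c, frame a x c μ • frameDeriv (jet m a ℓ x) c F) x := by
  intro i j
  exact (hasPd_eval hx μ (F i j)).of_eq (by simp [Fin.sum_univ_four, frameDeriv])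

/-! ### Christoffel symbols and Riemann tensor of the metric. -/

/-- The connection form in coordinates. -/
def connCoord (m a ℓ : ℝ) (μ : Fin 4) (x : Vec4) : Mat4 :=
  ∑ c, frame a x c μ • conn (jet m a ℓ x) c

theorem torsion_free (hx : x ∈ chart m a ℓ) (μ ν e : Fin 4) :
    (frameD a μ x + connCoord m a ℓ μ x * frame a x) e ν =
      (frameD a ν x + connCoord m a ℓ ν x * frame a x) e μ := by
  have h1 : ∀ μ ν, (connCoord m a ℓ μ x * frame a x) e ν =
      ∑ c, ∑ d, frame a x c μ * frame a x d ν * conn (jet m a ℓ x) c e d := by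
    intro μ ν
    simp only [connCoord, Matrix.mul_apply, Matrix.sum_apply, Matrix.smul_apply, smul_eq_mul,
      Finset.sum_mul]
    rw [Finset.sum_comm]
    exact Finset.sum_congr rfl fun c _ => Finset.sum_congr rfl fun d _ => by ring
  have h2 : (connCoord m a ℓ μ x * frame a x) e ν - (connCoord m a ℓ ν x * frame a x) e μ =
      ∑ c, ∑ d, frame a x c μ * frame a x d ν * structureFn (jet m a ℓ x) e c d := by
    rw [h1, h1, Finset.sum_comm (f := fun c d => frame a x c ν * _ * _), ← Finset.sum_sub_distrib]
    refine Finset.sum_congr rfl fun c _ => ?_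
    rw [← Finset.sum_sub_distrib]
    refine Finset.sum_congr rfl fun d _ => ?_
    rw [← conn_sub_conn (jet_S_ne hx)]
    ring
  have hS := (Sig_pos (a := a) hx.1).ne'
  -- The exterior derivatives of the four frame forms, expanded in the frame with the structure
  -- functions as coefficients.
  have h3 : frameD a μ x e ν - frameD a ν x e μ =
      -∑ c, ∑ d, frame a x c μ * frame a x d ν * structureFn (jet m a ℓ x) e c d := by
    have h4 : (jet m a ℓ x).a = a := rfl
    have h5 : (jet m a ℓ x).r = x 1 := rfl
    have h6 : (jet m a ℓ x).y = cos (x 2) := rfl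
    have h7 : Sig a x = x 1 ^ 2 + a ^ 2 * (1 - sin (x 2) ^ 2) := by rw [Sig, cos_sq']
    fin_cases e <;> fin_cases μ <;> fin_cases ν <;>
      simp [frameD, frame, structureFn, Fin.sum_univ_four, jet_S, h4, h5, h6] <;>
      field_simp <;> (try rw [h7]) <;> ring
  simp only [Matrix.add_apply]
  linarith

/-- The inverse of the metric in the frame. -/
def hInv (p : Jet) : Mat4 := Matrix.diagonal ![-(p.S / p.D), p.D / p.S, p.U / p.S, p.S / p.U]

theorem hMat_eq (p : Jet) :
    hMat p = Matrix.diagonal ![-(p.D / p.S), p.S / p.D, p.S / p.U, p.U / p.S] := by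
  ext i j
  fin_cases i <;> fin_cases j <;> simp [hMat, hTerm, Jet.S] <;> ring

theorem hMat_mul_hInv {p : Jet} (hS : p.S ≠ 0) (hU : p.U ≠ 0) (hD : p.D ≠ 0) :
    hMat p * hInv p = 1 := by
  rw [hMat_eq, hInv, Matrix.diagonal_mul_diagonal, ← Matrix.diagonal_one]
  congr 1
  ext i
  fin_cases i <;> simp <;> field_simp

theorem christoffel_metric (hx : x ∈ chart m a ℓ) (μ ν α : Fin 4) :
    christoffel (metric m a ℓ) μ ν α x =
      (dualFrame a x * (frameD a α x + connCoord m a ℓ α x * frame a x)) μ ν := by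
  refine christoffel_of_frame (A := fun α => frameD a α x) (Ω := fun α => connCoord m a ℓ α x)
    (h := fun z => hMat (jet m a ℓ z)) (k := hInv (jet m a ℓ x))
    ((eventually_mem_chart hx).mono fun z hz => metric_eq_frame hz) (frame_mul_dualFrame hx)
    (hMat_mul_hInv (jet_S_ne hx) (jet_U_ne hx) (jet_D_ne hx)) ?_ (fun μ => hasPdM_frame μ) ?_
    (torsion_free hx) μ ν α
  · rw [hMat_eq, Matrix.diagonal_transpose]
  · intro μ
    have e : ∑ c, frame a x c μ • frameDeriv (jet m a ℓ x) c hTerm =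
        hMat (jet m a ℓ x) * connCoord m a ℓ μ x
          + (connCoord m a ℓ μ x)ᵀ * hMat (jet m a ℓ x) := by
      simp only [connCoord, frameDeriv_hTerm (jet_S_ne hx) (jet_U_ne hx) (jet_D_ne hx),
        Matrix.transpose_sum, Matrix.transpose_smul, Finset.mul_sum, Finset.sum_mul, smul_add,
        Finset.sum_add_distrib, Matrix.mul_smul, Matrix.smul_mul]
    rw [← e]
    exact hasPdM_eval hx μ hTerm

/-- The value of the derivative is forced by duality with `frame`, so existence is all that
`riemann_of_frame` requires. -/
theorem hasPdM_dualFrame (hx : x ∈ chart m a ℓ) (μ : Fin 4) :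
    ∃ E', HasPdM μ (dualFrame a) E' x := by
  have hS := hasPd_eval hx μ Term.invS
  have hr := HasPd.comp_coord (μ := μ) (hasDerivAt_sq_add (a := a) (x 1))
  have hs := HasPd.comp_coord (μ := μ) (((hasDerivAt_sin (x 2)).pow 2).const_mul a)
  have hi := HasPd.comp_coord (μ := μ)
    ((hasDerivAt_sin (x 2)).inv (sin_pos_of_chart hx).ne').neg
  have h : ∀ i j, ∃ d, HasPd μ (fun z => dualFrame a z i j) d x := by
    intro i j
    fin_cases i <;> fin_cases j
    pick_goal 16
    · exact ⟨_, hS⟩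
    pick_goal 13
    · exact ⟨_, (HasPd.const a).mul hS⟩
    pick_goal 11
    · exact ⟨_, hi⟩
    pick_goal 6
    · exact ⟨0, HasPd.const 1⟩
    pick_goal 4
    · exact ⟨_, hs.mul hS⟩
    · exact ⟨_, hr.mul hS⟩
    all_goals exact ⟨0, HasPd.const 0⟩
  choose d hd using h
  exact ⟨d, hd⟩

theorem riemann_metric (hx : x ∈ chart m a ℓ) (μ ν α β : Fin 4) :
    riemann (metric m a ℓ) μ ν α β x =
      (dualFrame a x * (∑ c, ∑ d, (frame a x c α * frame a x d β) • curvature (jet m a ℓ x) c d)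
        * frame a x) μ ν := by
  choose E' hE' using hasPdM_dualFrame (m := m) (a := a) (ℓ := ℓ) hx
  have hev := eventually_mem_chart hx
  rw [riemann_of_frame (θ := frame a) (E := dualFrame a) (A := frameD a) (Ω := connCoord m a ℓ)
    (B := fun μ ν => frameDD a μ ν x)
    (dΩ := fun α β => ∑ c, (frameD a α x c β • conn (jet m a ℓ x) c
      + frame a x c β • ∑ d, frame a x d α • frameDeriv (jet m a ℓ x) d (connTerm c)))
    (hev.mono fun z hz => christoffel_metric hz) (hev.mono fun z hz => frame_mul_dualFrame hz) hE'
    (fun μ => hasPdM_frame μ) hasPdM_frameD frameDD_comm ?_]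
  · exact congrArg (fun M => (dualFrame a x * M * frame a x) μ ν)
      (curvature_of_frame_components (W := conn (jet m a ℓ x))
        (DW := fun c d => frameDeriv (jet m a ℓ x) c (connTerm d)) (torsion_free hx) α β)
  · intro α β
    exact HasPdM.sum fun c _ => HasPdM.smul (hasPdM_frame α c β) (hasPdM_eval hx α (connTerm c))

/-! ### Orthonormal components of the Riemann tensor. -/

theorem curvature_swap (p : Jet) (c d : Fin 4) : curvature p d c = -curvature p c d := by
  have h : ∑ e, (conn p d e c - conn p c e d) • conn p e =
      -∑ e, (conn p c e d - conn p d e c) • conn p e := by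
    rw [← Finset.sum_neg_distrib]
    exact Finset.sum_congr rfl fun e _ => by rw [← neg_smul, neg_sub]
  simp only [curvature, h]
  abel

theorem curvature_self (p : Jet) (c : Fin 4) : curvature p c c = 0 := by
  simp [curvature]

/-- The matrix of the orthonormal components `R^{αβ}_{μν}` for fixed `μ, ν`, where
`A = R^{01}_{01}`, `B = R^{23}_{23}`, `C = R^{02}_{02}`, `D = -R^{01}_{23} / 2` and `s` is the
sign of `Δ`. -/
def riemannTable (A B C D s : ℝ) : Fin 4 → Fin 4 → Mat4
  | 0, 1 => !![0, A, 0, 0; -A, 0, 0, 0; 0, 0, 0, 2 * D; 0, 0, -(2 * D), 0]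
  | 2, 3 => !![0, -(2 * D), 0, 0; 2 * D, 0, 0, 0; 0, 0, 0, B; 0, 0, -B, 0]
  | 0, 2 => !![0, 0, C, 0; 0, 0, 0, s * D; -C, 0, 0, 0; 0, -(s * D), 0, 0]
  | 1, 3 => !![0, 0, -(s * D), 0; 0, 0, 0, C; s * D, 0, 0, 0; 0, -C, 0, 0]
  | 0, 3 => !![0, 0, 0, C; 0, 0, -(s * D), 0; 0, s * D, 0, 0; -C, 0, 0, 0]
  | 1, 2 => !![0, 0, 0, s * D; 0, 0, C, 0; 0, -C, 0, 0; -(s * D), 0, 0, 0]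
  | 1, 0 => !![0, -A, 0, 0; A, 0, 0, 0; 0, 0, 0, -(2 * D); 0, 0, 2 * D, 0]
  | 3, 2 => !![0, 2 * D, 0, 0; -(2 * D), 0, 0, 0; 0, 0, 0, -B; 0, 0, B, 0]
  | 2, 0 => !![0, 0, -C, 0; 0, 0, 0, -(s * D); C, 0, 0, 0; 0, s * D, 0, 0]
  | 3, 1 => !![0, 0, s * D, 0; 0, 0, 0, -C; -(s * D), 0, 0, 0; 0, C, 0, 0]
  | 3, 0 => !![0, 0, 0, -C; 0, 0, s * D, 0; 0, -(s * D), 0, 0; C, 0, 0, 0]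
  | 2, 1 => !![0, 0, 0, -(s * D); 0, 0, -C, 0; 0, C, 0, 0; s * D, 0, 0, 0]
  | _, _ => 0

theorem riemannTable_swap (A B C D s : ℝ) (c d : Fin 4) :
    riemannTable A B C D s d c = -riemannTable A B C D s c d := by
  fin_cases c <;> fin_cases d <;> simp [riemannTable]

/-- The roots √Σ, √|Δ| and sin θ enter as free nonzero numbers σ, δ, u with Δ = s δ². Each entry is
thus again a rational identity, with s² = 1 as the only extra relation. -/
theorem curvature_normalized {p : Jet} {σ δ u s : ℝ} (hσ : σ ≠ 0) (hδ : δ ≠ 0) (hu : u ≠ 0)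
    (hS : p.S = σ ^ 2) (hU : p.U = u ^ 2) (hD : p.D = s * δ ^ 2) (hs : s = 1 ∨ s = -1)
    {n : Fin 4 → ℝ} (hn : n = ![-(δ / σ), σ / δ, -(σ / u), u / σ]) (α β μ ν : Fin 4) :
    n α * n β * (n μ)⁻¹ * (n ν)⁻¹ * (curvature p μ ν * hInv p) α β =
      riemannTable p.kA p.kB p.kC p.kD s μ ν α β := by
  have hs0 : s ≠ 0 := by rcases hs with rfl | rfl <;> norm_num
  have hs2 : s ^ 2 = 1 := by rcases hs with rfl | rfl <;> norm_num
  have hS0 : p.S ≠ 0 := by rw [hS]; positivity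
  have hU0 : p.U ≠ 0 := by rw [hU]; positivity
  have hD0 : p.D ≠ 0 := by rw [hD]; positivity
  have h01 := curvature_zero_one hS0 hU0 hD0
  have h23 := curvature_two_three hS0 hU0 hD0
  have h02 := curvature_zero_two hS0 hU0 hD0
  have h13 := curvature_one_three hS0 hU0 hD0
  have h03 := curvature_zero_three hS0 hU0 hD0
  have h12 := curvature_one_two hS0 hU0 hD0
  -- Ordered pairs with μ < ν are checked by cases; antisymmetry supplies the others.
  have key : ∀ μ ν : Fin 4, μ < ν → ∀ α β,
      n α * n β * (n μ)⁻¹ * (n ν)⁻¹ * (curvature p μ ν * hInv p) α β =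
      riemannTable p.kA p.kB p.kC p.kD s μ ν α β := by
    intro μ ν h α β
    rw [hInv, Matrix.mul_diagonal, hn]
    fin_cases μ <;> fin_cases ν <;> first
      | exact absurd h (by decide)
      | (simp only [Fin.zero_eta, Fin.mk_one, Fin.reduceFinMk, h01, h23, h02, h13, h03, h12]
         clear h01 h23 h02 h13 h03 h12
         fin_cases α <;> fin_cases β <;>
           simp [riemannTable, hS, hU, hD] <;> field_simp <;> simp [hs2])
  rcases lt_trichotomy μ ν with h | rfl | h
  · exact key μ ν h α β
  · rw [curvature_self]
    fin_cases μ <;> simp [riemannTable]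
  · rw [curvature_swap, riemannTable_swap, Matrix.neg_mul, Matrix.neg_apply, Matrix.neg_apply,
      ← key ν μ h α β]
    ring

/-- The factors that turn the rational frame into the orthonormal one. -/
def normFactor (m a ℓ : ℝ) (x : Vec4) : Fin 4 → ℝ :=
  ![-(√|Del m a ℓ x| / √(Sig a x)), √(Sig a x) / √|Del m a ℓ x|,
    -(√(Sig a x) / sin (x 2)), sin (x 2) / √(Sig a x)]

theorem sqrt_Sig_pos (hr : 0 < x 1) : 0 < √(Sig a x) := sqrt_pos.mpr (Sig_pos hr)

theorem sqrt_abs_Del_pos (hx : x ∈ chart m a ℓ) : 0 < √|Del m a ℓ x| :=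
  sqrt_pos.mpr (abs_pos.mpr hx.2.2.2)

theorem normFactor_ne_zero (hx : x ∈ chart m a ℓ) (α : Fin 4) : normFactor m a ℓ x α ≠ 0 := by
  have h1 := (sqrt_Sig_pos (a := a) hx.1).ne'
  have h2 := (sqrt_abs_Del_pos hx).ne'
  have h3 := (sin_pos_of_chart hx).ne'
  fin_cases α <;> simp [normFactor, h1, h2, h3]

/-- The third factor is negative because the frame contains d cos θ = -sin θ dθ; the first follows
the sign convention of the co-tetrad. -/
theorem cotetrad_eq (hx : x ∈ chart m a ℓ) :
    cotetrad m a ℓ x = Matrix.diagonal (normFactor m a ℓ x) * frame a x := by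
  have h3 := (sin_pos_of_chart hx).ne'
  have h1 := (sqrt_Sig_pos (a := a) hx.1).ne'
  ext i j
  rw [Matrix.diagonal_mul]
  fin_cases i <;> fin_cases j <;>
    simp [cotetrad, normFactor, frame, formT, formR, formTheta, formPhi,
      sqrt_div (abs_nonneg (Del m a ℓ x)), sqrt_div (Sig_pos (a := a) hx.1).le]
  all_goals field_simp

theorem tetrad_eq (hx : x ∈ chart m a ℓ) :
    tetrad m a ℓ x =
      Matrix.diagonal (fun α => (normFactor m a ℓ x α)⁻¹) * (dualFrame a x)ᵀ := by
  have h1 := (sqrt_Sig_pos (a := a) hx.1).ne'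
  have h2 := (sqrt_abs_Del_pos hx).ne'
  have h3 := (sin_pos_of_chart hx).ne'
  have h4 : (Sig a x) = √(Sig a x) ^ 2 := (sq_sqrt (Sig_pos hx.1).le).symm
  have h5 := (Sig_pos (a := a) hx.1).ne'
  ext i j
  rw [Matrix.diagonal_mul]
  fin_cases i <;> fin_cases j <;>
    simp [tetrad, normFactor, dualFrame, sqrt_mul (Sig_pos (a := a) hx.1).le,
      sqrt_div (abs_nonneg (Del m a ℓ x))] <;>
    (try field_simp) <;> (try rw [← h4]) <;> (try field_simp [h5])

theorem cotetrad_mul_tetrad (hx : x ∈ chart m a ℓ) :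
    cotetrad m a ℓ x * (tetrad m a ℓ x)ᵀ = 1 := by
  rw [cotetrad_eq hx, tetrad_eq hx, Matrix.transpose_mul, Matrix.transpose_transpose,
    Matrix.diagonal_transpose, Matrix.mul_assoc, ← Matrix.mul_assoc (frame a x),
    frame_mul_dualFrame hx, Matrix.one_mul, Matrix.diagonal_mul_diagonal, ← Matrix.diagonal_one]
  congr 1
  ext i
  exact mul_inv_cancel₀ (normFactor_ne_zero hx i)

theorem metric_inv (hx : x ∈ chart m a ℓ) :
    (metric m a ℓ x)⁻¹ = dualFrame a x * hInv (jet m a ℓ x) * (dualFrame a x)ᵀ :=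
  metric_inv_of_frame (metric_eq_frame hx) (frame_mul_dualFrame hx)
    (hMat_mul_hInv (jet_S_ne hx) (jet_U_ne hx) (jet_D_ne hx))

theorem sum_rotate₅ (F : Fin 4 → Fin 4 → Fin 4 → Fin 4 → Fin 4 → ℝ) :
    ∑ i, ∑ j, ∑ k, ∑ p, ∑ q, F i j k p q = ∑ p, ∑ q, ∑ i, ∑ j, ∑ k, F i j k p q := by
  have h : ∀ G : Fin 4 → Fin 4 → Fin 4 → Fin 4 → ℝ,
      ∑ i, ∑ j, ∑ k, ∑ p, G i j k p = ∑ p, ∑ i, ∑ j, ∑ k, G i j k p := by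
    intro G
    rw [Finset.sum_comm (s := (Finset.univ : Finset (Fin 4)))
      (f := fun p i => ∑ j, ∑ k, G i j k p)]
    refine Finset.sum_congr rfl fun i _ => ?_
    rw [Finset.sum_comm (s := (Finset.univ : Finset (Fin 4))) (f := fun p j => ∑ k, G i j k p)]
    refine Finset.sum_congr rfl fun j _ => ?_
    rw [Finset.sum_comm]
  rw [h]
  refine Finset.sum_congr rfl fun p _ => ?_
  rw [h]

theorem sum_contract (C G R : Mat4) (α β : Fin 4) :
    ∑ i, ∑ j, ∑ k, C α i * C β j * (G j k * R i k) = (C * R * Gᵀ * Cᵀ) α β := by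
  simp only [Matrix.mul_apply, Matrix.transpose_apply, Finset.sum_mul]
  rw [Finset.sum_comm]
  refine Finset.sum_congr rfl fun j _ => ?_
  rw [Finset.sum_comm]
  exact Finset.sum_congr rfl fun k _ => Finset.sum_congr rfl fun i _ => by ring

/-- Duality of the two frames removes all coordinate matrices. What remains is one factor
`normFactor` for each upper index and its inverse for each lower one. -/
theorem orthoRiemann_eq_curvature (hx : x ∈ chart m a ℓ) (α β μ ν : Fin 4) :
    orthoRiemann m a ℓ x α β μ ν =
      normFactor m a ℓ x α * normFactor m a ℓ x β * (normFactor m a ℓ x μ)⁻¹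
        * (normFactor m a ℓ x ν)⁻¹
        * (curvature (jet m a ℓ x) μ ν * hInv (jet m a ℓ x)) α β := by
  set N := Matrix.diagonal (normFactor m a ℓ x) with hN
  set K := curvature (jet m a ℓ x) with hK
  set θ := frame a x with hθ
  set E := dualFrame a x with hE
  have hθE : θ * E = 1 := frame_mul_dualFrame hx
  have hEθ : Eᵀ * θᵀ = 1 := by rw [← Matrix.transpose_mul, hθE, Matrix.transpose_one]
  have hhT : (hInv (jet m a ℓ x))ᵀ = hInv (jet m a ℓ x) := by rw [hInv, Matrix.diagonal_transpose]
  have hmat : ∀ p q, (cotetrad m a ℓ x * Matrix.of (fun i k => riemann (metric m a ℓ) i k p q x)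
      * ((metric m a ℓ x)⁻¹)ᵀ * (cotetrad m a ℓ x)ᵀ) =
      N * ((∑ c, ∑ d, (θ c p * θ d q) • K c d) * hInv (jet m a ℓ x)) * N := by
    intro p q
    have hR : Matrix.of (fun i k => riemann (metric m a ℓ) i k p q x) =
        E * (∑ c, ∑ d, (θ c p * θ d q) • K c d) * θ := by
      ext i k
      exact riemann_metric hx i k p q
    rw [hR, metric_inv hx, cotetrad_eq hx]
    simp only [Matrix.transpose_mul, Matrix.transpose_transpose, hhT, ← hN, ← hθ, ← hE]
    rw [hN, Matrix.diagonal_transpose, ← hN]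
    generalize (∑ c, ∑ d, (θ c p * θ d q) • K c d) = X
    calc N * θ * (E * X * θ) * (E * (hInv (jet m a ℓ x) * Eᵀ)) * (θᵀ * N)
        = N * (θ * E) * X * (θ * E) * hInv (jet m a ℓ x) * (Eᵀ * θᵀ) * N := by noncomm_ring
      _ = _ := by rw [hθE, hEθ]; noncomm_ring
  have htet : ∀ μ c, ∑ p, tetrad m a ℓ x μ p * θ c p =
      if μ = c then (normFactor m a ℓ x μ)⁻¹ else 0 := by
    intro μ c
    have h : tetrad m a ℓ x * θᵀ = Matrix.diagonal (fun α => (normFactor m a ℓ x α)⁻¹) := by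
      rw [tetrad_eq hx, Matrix.mul_assoc, hEθ, Matrix.mul_one]
    have h' := congrFun (congrFun h μ) c
    rwa [Matrix.diagonal_apply] at h'
  have hsum : ∀ X : Fin 4 → Fin 4 → Mat4,
      (∑ p, ∑ q, (tetrad m a ℓ x μ p * tetrad m a ℓ x ν q) • ∑ c, ∑ d, (θ c p * θ d q) • X c d) =
      ((normFactor m a ℓ x μ)⁻¹ * (normFactor m a ℓ x ν)⁻¹) • X μ ν := by
    intro X
    have h1 : (∑ p, ∑ q, (tetrad m a ℓ x μ p * tetrad m a ℓ x ν q) •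
        ∑ c, ∑ d, (θ c p * θ d q) • X c d) =
        ∑ c, ∑ d, ((∑ p, tetrad m a ℓ x μ p * θ c p) * (∑ q, tetrad m a ℓ x ν q * θ d q)) •
          X c d := by
      simp only [Finset.smul_sum, Finset.sum_smul, Finset.sum_mul, Finset.mul_sum, smul_smul]
      calc _ = ∑ p, ∑ c, ∑ q, ∑ d, (tetrad m a ℓ x μ p * tetrad m a ℓ x ν q
              * (θ c p * θ d q)) • X c d := Finset.sum_congr rfl fun p _ => Finset.sum_comm
        _ = ∑ c, ∑ p, ∑ q, ∑ d, (tetrad m a ℓ x μ p * tetrad m a ℓ x ν q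
              * (θ c p * θ d q)) • X c d := Finset.sum_comm
        _ = ∑ c, ∑ p, ∑ d, ∑ q, (tetrad m a ℓ x μ p * tetrad m a ℓ x ν q
              * (θ c p * θ d q)) • X c d :=
            Finset.sum_congr rfl fun c _ => Finset.sum_congr rfl fun p _ => Finset.sum_comm
        _ = ∑ c, ∑ d, ∑ p, ∑ q, (tetrad m a ℓ x μ p * tetrad m a ℓ x ν q
              * (θ c p * θ d q)) • X c d := Finset.sum_congr rfl fun c _ => Finset.sum_comm
        _ = ∑ c, ∑ d, ∑ p, ∑ q, (tetrad m a ℓ x μ p * θ c p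
              * (tetrad m a ℓ x ν q * θ d q)) • X c d := by
            simp only [mul_mul_mul_comm]
        _ = _ := by
            refine Finset.sum_congr rfl fun c _ => Finset.sum_congr rfl fun d _ => ?_
            rw [Finset.sum_comm]
    rw [h1]
    simp [htet]
  calc orthoRiemann m a ℓ x α β μ ν
      = ∑ p, ∑ q, tetrad m a ℓ x μ p * tetrad m a ℓ x ν q *
          (N * ((∑ c, ∑ d, (θ c p * θ d q) • K c d) * hInv (jet m a ℓ x)) * N) α β := by
        rw [orthoRiemann, sum_rotate₅]
        refine Finset.sum_congr rfl fun p _ => Finset.sum_congr rfl fun q _ => ?_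
        rw [← hmat, ← sum_contract]
        simp only [Finset.mul_sum, Matrix.of_apply]
        refine Finset.sum_congr rfl fun i _ => Finset.sum_congr rfl fun j _ =>
          Finset.sum_congr rfl fun k _ => by ring
    _ = (N * ((∑ p, ∑ q, (tetrad m a ℓ x μ p * tetrad m a ℓ x ν q) •
          ∑ c, ∑ d, (θ c p * θ d q) • K c d) * hInv (jet m a ℓ x)) * N) α β := by
        simp only [Finset.sum_mul, Finset.mul_sum, Matrix.sum_apply, Matrix.smul_mul,
          Matrix.mul_smul, Matrix.smul_apply, smul_eq_mul, Finset.smul_sum]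
    _ = _ := by
        rw [hsum K, Matrix.smul_mul, Matrix.mul_smul, Matrix.smul_mul, Matrix.smul_apply, hN,
          Matrix.mul_diagonal, Matrix.diagonal_mul, smul_eq_mul]
        ring

theorem sign_eq_one_or (h : Del m a ℓ x ≠ 0) :
    Real.sign (Del m a ℓ x) = 1 ∨ Real.sign (Del m a ℓ x) = -1 :=
  (Real.sign_apply_eq_of_ne_zero _ h).symm

theorem Del_eq_sign_mul : Del m a ℓ x = Real.sign (Del m a ℓ x) * √|Del m a ℓ x| ^ 2 := by
  rw [sq_sqrt (abs_nonneg _)]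
  rcases lt_trichotomy (Del m a ℓ x) 0 with h | h | h
  · rw [Real.sign_of_neg h, abs_of_neg h]
    ring
  · simp [h]
  · rw [Real.sign_of_pos h, abs_of_pos h, one_mul]

theorem orthoRiemann_eq (hx : x ∈ chart m a ℓ) (α β μ ν : Fin 4) :
    orthoRiemann m a ℓ x α β μ ν =
      riemannTable (jet m a ℓ x).kA (jet m a ℓ x).kB (jet m a ℓ x).kC (jet m a ℓ x).kD
        (Real.sign (Del m a ℓ x)) μ ν α β := by
  rw [orthoRiemann_eq_curvature hx]
  exact curvature_normalized (p := jet m a ℓ x) (sqrt_Sig_pos (a := a) hx.1).ne'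
    (sqrt_abs_Del_pos hx).ne' (sin_pos_of_chart hx).ne' (sq_sqrt (Sig_pos (a := a) hx.1).le).symm jet_U Del_eq_sign_mul
    (sign_eq_one_or hx.2.2.2) rfl α β μ ν

/-! ### Ricci and Einstein tensors. -/

/-- Row c of the curvature matrix for the pair (c, d) has its only nonzero entry in column d. So the
contraction never meets `kD`, and no off-diagonal term arises. -/
theorem ricci_curvature {p : Jet} (hS : p.S ≠ 0) (hU : p.U ≠ 0) (hD : p.D ≠ 0) :
    (Matrix.of fun b d => ∑ c, curvature p c d c b) =
      hMat p * Matrix.diagonal ![p.kA + 2 * p.kC, p.kA + 2 * p.kC, p.kB + 2 * p.kC,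
        p.kB + 2 * p.kC] := by
  have h01 := curvature_zero_one hS hU hD
  have h23 := curvature_two_three hS hU hD
  have h02 := curvature_zero_two hS hU hD
  have h13 := curvature_one_three hS hU hD
  have h03 := curvature_zero_three hS hU hD
  have h12 := curvature_one_two hS hU hD
  have h := curvature_swap p
  rw [hMat_eq, Matrix.diagonal_mul_diagonal]
  ext b d
  rw [Matrix.of_apply, Fin.sum_univ_four]
  fin_cases d <;>
    simp only [Fin.zero_eta, Fin.mk_one, Fin.reduceFinMk, curvature_self, h 0 1, h 0 2, h 0 3, h 1 2,
      h 1 3, h 2 3, h01, h02, h03, h12, h13, h23] <;>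
    fin_cases b <;> simp <;> ring

theorem ricci_metric (hx : x ∈ chart m a ℓ) :
    ricci (metric m a ℓ) x = (frame a x)ᵀ * (hMat (jet m a ℓ x) * Matrix.diagonal
      ![(jet m a ℓ x).kA + 2 * (jet m a ℓ x).kC, (jet m a ℓ x).kA + 2 * (jet m a ℓ x).kC,
        (jet m a ℓ x).kB + 2 * (jet m a ℓ x).kC, (jet m a ℓ x).kB + 2 * (jet m a ℓ x).kC])
      * frame a x := by
  rw [← ricci_curvature (jet_S_ne hx) (jet_U_ne hx) (jet_D_ne hx)]
  set θ := frame a x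
  set E := dualFrame a x
  set K := curvature (jet m a ℓ x)
  have hθE : θ * E = 1 := frame_mul_dualFrame hx
  ext μ ν
  have h1 : ricci (metric m a ℓ) x μ ν =
      ∑ σ, ∑ c, ∑ d, θ c σ * θ d ν * (E * (K c d * θ)) σ μ := by
    simp only [ricci, Matrix.of_apply, riemann_metric hx, Finset.mul_sum, Finset.sum_mul,
      Matrix.sum_apply, Matrix.mul_smul, Matrix.smul_mul, Matrix.smul_apply, smul_eq_mul,
      Matrix.mul_assoc]
    rfl
  have h2 : ∀ c d, ∑ σ, θ c σ * θ d ν * (E * (K c d * θ)) σ μ = θ d ν * (K c d * θ) c μ := by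
    intro c d
    calc _ = θ d ν * (θ * (E * (K c d * θ))) c μ := by
          rw [Matrix.mul_apply, Finset.mul_sum]
          exact Finset.sum_congr rfl fun σ _ => by ring
      _ = _ := by rw [← Matrix.mul_assoc, hθE, Matrix.one_mul]
  rw [h1, Finset.sum_comm]
  have h3 : ∑ c, ∑ σ, ∑ d, θ c σ * θ d ν * (E * (K c d * θ)) σ μ =
      ∑ c, ∑ d, θ d ν * (K c d * θ) c μ := by
    refine Finset.sum_congr rfl fun c _ => ?_
    rw [Finset.sum_comm]
    exact Finset.sum_congr rfl fun d _ => h2 c d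
  rw [h3, Finset.sum_comm]
  simp only [Matrix.mul_apply, Matrix.of_apply, Matrix.transpose_apply, Finset.mul_sum,
    Finset.sum_mul]
  refine Finset.sum_congr rfl fun d _ => ?_
  rw [Finset.sum_comm]
  exact Finset.sum_congr rfl fun b _ => Finset.sum_congr rfl fun c _ => by ring

theorem hMat_eq_normFactor (hx : x ∈ chart m a ℓ) :
    hMat (jet m a ℓ x) = Matrix.diagonal (normFactor m a ℓ x) * Matrix.diagonal (eta m a ℓ x)
      * Matrix.diagonal (normFactor m a ℓ x) := by
  have h1 := (sqrt_Sig_pos (a := a) hx.1).ne'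
  have h2 := (sqrt_abs_Del_pos hx).ne'
  have h3 := (sin_pos_of_chart hx).ne'
  have h4 : (jet m a ℓ x).S = √(Sig a x) ^ 2 := (sq_sqrt (Sig_pos (a := a) hx.1).le).symm
  have h5 : (jet m a ℓ x).D = Real.sign (Del m a ℓ x) * √|Del m a ℓ x| ^ 2 := Del_eq_sign_mul
  rw [hMat_eq, Matrix.diagonal_mul_diagonal, Matrix.diagonal_mul_diagonal, h4, h5, jet_U]
  congr 1
  ext i
  rcases sign_eq_one_or hx.2.2.2 with h | h <;>
    fin_cases i <;> simp [normFactor, eta, h] <;> field_simp <;>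
      simp [sq_sqrt (abs_nonneg (Del m a ℓ x)), hx.2.2.2]

theorem metric_eq_cotetrad (hx : x ∈ chart m a ℓ) :
    metric m a ℓ x = (cotetrad m a ℓ x)ᵀ * Matrix.diagonal (eta m a ℓ x) * cotetrad m a ℓ x := by
  rw [metric_eq_frame hx, hMat_eq_normFactor hx, cotetrad_eq hx, Matrix.transpose_mul,
    Matrix.diagonal_transpose]
  noncomm_ring

theorem eta_mul_eta (hx : x ∈ chart m a ℓ) (α : Fin 4) : eta m a ℓ x α * eta m a ℓ x α = 1 := by
  rcases sign_eq_one_or hx.2.2.2 with h | h <;> fin_cases α <;> simp [eta, h]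

theorem diagonal_eta_mul_self (hx : x ∈ chart m a ℓ) :
    Matrix.diagonal (eta m a ℓ x) * Matrix.diagonal (eta m a ℓ x) = 1 := by
  simp [Matrix.diagonal_mul_diagonal, eta_mul_eta hx]

theorem metric_inv_eq_tetrad (hx : x ∈ chart m a ℓ) :
    (metric m a ℓ x)⁻¹ = (tetrad m a ℓ x)ᵀ * Matrix.diagonal (eta m a ℓ x) * tetrad m a ℓ x := by
  have h := metric_inv_of_frame (metric_eq_cotetrad hx) (cotetrad_mul_tetrad hx)
    (diagonal_eta_mul_self hx)
  rwa [Matrix.transpose_transpose] at h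

/-- The two frames differ by a diagonal rescaling, which commutes with diagonal matrices, so mixed
diagonal components agree in both. -/
theorem frame_diagonal_eq_cotetrad (hx : x ∈ chart m a ℓ) (t : Fin 4 → ℝ) :
    (frame a x)ᵀ * (hMat (jet m a ℓ x) * Matrix.diagonal t) * frame a x =
      (cotetrad m a ℓ x)ᵀ * Matrix.diagonal (fun α => eta m a ℓ x α * t α)
        * cotetrad m a ℓ x := by
  have hc : Matrix.diagonal (normFactor m a ℓ x) * Matrix.diagonal t =
      Matrix.diagonal t * Matrix.diagonal (normFactor m a ℓ x) := by
    simp only [Matrix.diagonal_mul_diagonal, mul_comm]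
  rw [← Matrix.diagonal_mul_diagonal, hMat_eq_normFactor hx, cotetrad_eq hx, Matrix.transpose_mul,
    Matrix.diagonal_transpose, Matrix.mul_assoc _ _ (Matrix.diagonal t), hc]
  noncomm_ring

/-- Contraction of the inverse metric with a tensor that is diagonal in the tetrad. -/
theorem trace_diagonal (hx : x ∈ chart m a ℓ) (t : Fin 4 → ℝ) :
    ∑ μ, ∑ ν, (metric m a ℓ x)⁻¹ μ ν * ((cotetrad m a ℓ x)ᵀ *
      Matrix.diagonal (fun α => eta m a ℓ x α * t α) * cotetrad m a ℓ x) μ ν = ∑ α, t α := by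
  have hct := cotetrad_mul_tetrad hx
  have htc : tetrad m a ℓ x * (cotetrad m a ℓ x)ᵀ = 1 := by
    rw [← Matrix.transpose_transpose (tetrad m a ℓ x), ← Matrix.transpose_mul, hct,
      Matrix.transpose_one]
  set A := (cotetrad m a ℓ x)ᵀ * Matrix.diagonal (fun α => eta m a ℓ x α * t α) *
    cotetrad m a ℓ x with hA
  have hAT : Aᵀ = A := by
    rw [hA]
    simp only [Matrix.transpose_mul, Matrix.transpose_transpose, Matrix.diagonal_transpose,
      Matrix.mul_assoc]
  have h1 : ∑ μ, ∑ ν, (metric m a ℓ x)⁻¹ μ ν * A μ ν = ((metric m a ℓ x)⁻¹ * A).trace := by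
    conv_rhs => rw [← hAT]
    simp [Matrix.trace, Matrix.mul_apply]
  have h2 : Matrix.diagonal (eta m a ℓ x) * Matrix.diagonal (fun α => eta m a ℓ x α * t α) =
      Matrix.diagonal t := by
    rw [Matrix.diagonal_mul_diagonal]
    congr 1
    ext α
    rw [← mul_assoc, eta_mul_eta hx, one_mul]
  have h3 : (metric m a ℓ x)⁻¹ * A =
      (tetrad m a ℓ x)ᵀ * (Matrix.diagonal t * cotetrad m a ℓ x) := by
    calc (metric m a ℓ x)⁻¹ * A = (tetrad m a ℓ x)ᵀ * Matrix.diagonal (eta m a ℓ x)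
          * (tetrad m a ℓ x * (cotetrad m a ℓ x)ᵀ)
          * Matrix.diagonal (fun α => eta m a ℓ x α * t α) * cotetrad m a ℓ x := by
          rw [metric_inv_eq_tetrad hx, hA]
          noncomm_ring
      _ = (tetrad m a ℓ x)ᵀ * (Matrix.diagonal (eta m a ℓ x)
          * Matrix.diagonal (fun α => eta m a ℓ x α * t α)) * cotetrad m a ℓ x := by
          rw [htc]
          noncomm_ring
      _ = _ := by rw [h2, Matrix.mul_assoc]
  rw [h1, h3, Matrix.trace_mul_comm, Matrix.mul_assoc, hct, Matrix.mul_one, Matrix.trace_diagonal]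

/-- Mixed tetrad components of a tensor that is diagonal in the tetrad. -/
theorem orthoMixed_diagonal (hx : x ∈ chart m a ℓ) (t : Fin 4 → ℝ) (α β : Fin 4) :
    orthoMixed m a ℓ x ((cotetrad m a ℓ x)ᵀ *
      Matrix.diagonal (fun α => eta m a ℓ x α * t α) * cotetrad m a ℓ x) α β =
      Matrix.diagonal t α β := by
  have hct := cotetrad_mul_tetrad hx
  have htc : tetrad m a ℓ x * (cotetrad m a ℓ x)ᵀ = 1 := by
    rw [← Matrix.transpose_transpose (tetrad m a ℓ x), ← Matrix.transpose_mul, hct,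
      Matrix.transpose_one]
  have h1 : ∀ A : Mat4, orthoMixed m a ℓ x A α β =
      (cotetrad m a ℓ x * ((metric m a ℓ x)⁻¹ * (A * (tetrad m a ℓ x)ᵀ))) α β := by
    intro A
    simp only [orthoMixed, Matrix.mul_apply, Matrix.transpose_apply, Finset.mul_sum, mul_assoc]
  have h2 : Matrix.diagonal (eta m a ℓ x) * Matrix.diagonal (fun α => eta m a ℓ x α * t α) =
      Matrix.diagonal t := by
    rw [Matrix.diagonal_mul_diagonal]
    congr 1
    ext α
    rw [← mul_assoc, eta_mul_eta hx, one_mul]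
  rw [h1, metric_inv_eq_tetrad hx]
  set D := Matrix.diagonal (fun α => eta m a ℓ x α * t α)
  refine congrFun (congrFun (?_ : _ * _ = Matrix.diagonal t) α) β
  calc _ = cotetrad m a ℓ x * (tetrad m a ℓ x)ᵀ * Matrix.diagonal (eta m a ℓ x)
        * (tetrad m a ℓ x * (cotetrad m a ℓ x)ᵀ) * D
        * (cotetrad m a ℓ x * (tetrad m a ℓ x)ᵀ) := by noncomm_ring
    _ = Matrix.diagonal t := by rw [hct, htc, Matrix.one_mul, Matrix.mul_one, Matrix.mul_one, h2]

/-- The mixed components of the Einstein tensor in the tetrad. -/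
def einsteinDiag (m a ℓ : ℝ) (x : Vec4) : Fin 4 → ℝ := fun α =>
  -(2 * ℓ * m * exp (-ℓ / x 1) / Sig a x ^ 2) * ![1, 1, Xi a ℓ x - 1, Xi a ℓ x - 1] α

theorem kA_eq (hx : x ∈ chart m a ℓ) : (jet m a ℓ x).kA =
    2 * x 1 ^ 3 * massFn m ℓ (x 1) / Sig a x ^ 3 *
      (2 * Xi a ℓ x ^ 2 - 4 * Xi a ℓ x + 1 - 3 * (a / x 1) ^ 2 * cos (x 2) ^ 2) := by
  have hS := (Sig_pos (a := a) hx.1).ne'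
  have hr := hx.1.ne'
  simp only [Jet.kA, jet_S]
  simp only [jet, Del, massFn, Xi]
  field_simp
  simp only [Sig]
  ring

theorem kB_eq (hx : x ∈ chart m a ℓ) : (jet m a ℓ x).kB =
    2 * x 1 ^ 3 * massFn m ℓ (x 1) / Sig a x ^ 3 *
      (1 - 3 * (a / x 1) ^ 2 * cos (x 2) ^ 2) := by
  have hS := (Sig_pos (a := a) hx.1).ne'
  have hr := hx.1.ne'
  simp only [Jet.kB, jet_S]
  simp only [jet, Del, massFn]
  field_simp
  ring

theorem kC_eq (hx : x ∈ chart m a ℓ) : (jet m a ℓ x).kC =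
    x 1 ^ 3 * massFn m ℓ (x 1) / Sig a x ^ 3 *
      (2 * Xi a ℓ x + 3 * (a / x 1) ^ 2 * cos (x 2) ^ 2 - 1) := by
  have hS := (Sig_pos (a := a) hx.1).ne'
  have hr := hx.1.ne'
  simp only [Jet.kC, jet_S]
  simp only [jet, Del, massFn, Xi]
  field_simp
  ring

theorem kD_eq (hx : x ∈ chart m a ℓ) : (jet m a ℓ x).kD =
    a * cos (x 2) * x 1 ^ 2 * massFn m ℓ (x 1) / Sig a x ^ 3 *
      (2 * Xi a ℓ x + (a / x 1) ^ 2 * cos (x 2) ^ 2 - 3) := by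
  have hS := (Sig_pos (a := a) hx.1).ne'
  have hr := hx.1.ne'
  simp only [Jet.kD, jet_S]
  simp only [jet, Del, massFn, Xi]
  field_simp
  simp only [Sig]
  ring

theorem einstein_metric (hx : x ∈ chart m a ℓ) :
    einstein (metric m a ℓ) x = (cotetrad m a ℓ x)ᵀ *
      Matrix.diagonal (fun α => eta m a ℓ x α * einsteinDiag m a ℓ x α) * cotetrad m a ℓ x := by
  have hS := (Sig_pos (a := a) hx.1).ne'
  have hr := hx.1.ne'
  have h1 := ricci_metric hx
  rw [frame_diagonal_eq_cotetrad hx] at h1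
  have h2 : ricciScalar (metric m a ℓ) x =
      2 * (jet m a ℓ x).kA + 8 * (jet m a ℓ x).kC + 2 * (jet m a ℓ x).kB := by
    rw [ricciScalar, h1, trace_diagonal hx, Fin.sum_univ_four]
    simp
    ring
  have h3 : ∀ (c : ℝ) (u v : Fin 4 → ℝ) (C : Mat4), Cᵀ * Matrix.diagonal u * C
      - c • (Cᵀ * Matrix.diagonal v * C) = Cᵀ * Matrix.diagonal (u - c • v) * C := by
    intro c u v C
    have : Matrix.diagonal (u - c • v) = Matrix.diagonal u - c • Matrix.diagonal v := by
      rw [← Matrix.diagonal_smul, Matrix.diagonal_sub]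
      rfl
    rw [this, Matrix.mul_sub, Matrix.sub_mul, Matrix.mul_smul, Matrix.smul_mul]
  rw [einstein, h2, h1, metric_eq_cotetrad hx, h3]
  congr 3
  -- In this combination and in `h5` the terms with a² cos²θ cancel, and the Einstein tensor depends
  -- on the angle only through Σ.
  have h4 : 2 * (jet m a ℓ x).kC + (jet m a ℓ x).kB =
      2 * ℓ * m * exp (-ℓ / x 1) / Sig a x ^ 2 := by
    rw [kC_eq hx, kB_eq hx, massFn, Xi]
    field_simp
    ring
  have h5 : (jet m a ℓ x).kA + 2 * (jet m a ℓ x).kC =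
      2 * ℓ * m * exp (-ℓ / x 1) / Sig a x ^ 2 * (Xi a ℓ x - 1) := by
    rw [kC_eq hx, kA_eq hx, massFn, Xi]
    field_simp
    ring
  ext α
  have h6 : (fun α => eta m a ℓ x α * ![(jet m a ℓ x).kA + 2 * (jet m a ℓ x).kC,
      (jet m a ℓ x).kA + 2 * (jet m a ℓ x).kC, (jet m a ℓ x).kB + 2 * (jet m a ℓ x).kC,
      (jet m a ℓ x).kB + 2 * (jet m a ℓ x).kC] α) α - (1 / 2 * (2 * (jet m a ℓ x).kA +
      8 * (jet m a ℓ x).kC + 2 * (jet m a ℓ x).kB)) * eta m a ℓ x α =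
      eta m a ℓ x α * ![-(2 * (jet m a ℓ x).kC + (jet m a ℓ x).kB),
        -(2 * (jet m a ℓ x).kC + (jet m a ℓ x).kB), -((jet m a ℓ x).kA + 2 * (jet m a ℓ x).kC),
        -((jet m a ℓ x).kA + 2 * (jet m a ℓ x).kC)] α := by
    fin_cases α <;> simp <;> ring
  rw [Pi.sub_apply, Pi.smul_apply, smul_eq_mul, h6, h4, h5]
  fin_cases α <;> simp [einsteinDiag]

/-! ### Stress-energy tensor and energy conditions. -/

/-- The energy density in closed form. -/
def density (m a ℓ : ℝ) (x : Vec4) : ℝ := ℓ * m * exp (-ℓ / x 1) / (4 * π * Sig a x ^ 2)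

theorem density_pos (hm : 0 < m) (hℓ : 0 < ℓ) (hr : 0 < x 1) : 0 < density m a ℓ x := by
  have hS := Sig_pos (a := a) hr
  unfold density
  positivity

/-- The mixed components of the stress-energy tensor in the tetrad. -/
def stressDiag (m a ℓ : ℝ) (x : Vec4) : Fin 4 → ℝ :=
  ![-density m a ℓ x, -density m a ℓ x, density m a ℓ x * (1 - Xi a ℓ x),
    density m a ℓ x * (1 - Xi a ℓ x)]

theorem stress_eq (hx : x ∈ chart m a ℓ) :
    stress m a ℓ x = (cotetrad m a ℓ x)ᵀ *
      Matrix.diagonal (fun α => eta m a ℓ x α * stressDiag m a ℓ x α) * cotetrad m a ℓ x := by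
  have hS := (Sig_pos (a := a) hx.1).ne'
  have h1 : (fun α => eta m a ℓ x α * stressDiag m a ℓ x α) =
      (1 / (8 * π)) • fun α => eta m a ℓ x α * einsteinDiag m a ℓ x α := by
    ext α
    rw [Pi.smul_apply, smul_eq_mul, ← mul_assoc, mul_comm (1 / (8 * π)), mul_assoc]
    congr 1
    fin_cases α <;> simp [stressDiag, einsteinDiag, density] <;> field_simp <;> ring
  rw [stress, stressEnergy, einstein_metric hx, h1, Matrix.diagonal_smul, Matrix.mul_smul,
    Matrix.smul_mul]

theorem cotetrad_mulVec_tetrad (hx : x ∈ chart m a ℓ) (α : Fin 4) :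
    cotetrad m a ℓ x *ᵥ tetrad m a ℓ x α = Pi.single α 1 := by
  ext β
  have h := congrFun (congrFun (cotetrad_mul_tetrad hx) β) α
  rw [Matrix.one_apply] at h
  rw [Pi.single_apply, ← h]
  rfl

theorem eval2_plane (hx : x ∈ chart m a ℓ) (d : Fin 4 → ℝ) {i j : Fin 4} (hij : i ≠ j) (b c : ℝ) :
    eval2 ((cotetrad m a ℓ x)ᵀ * Matrix.diagonal d * cotetrad m a ℓ x)
      (b • tetrad m a ℓ x i + c • tetrad m a ℓ x j) (b • tetrad m a ℓ x i + c • tetrad m a ℓ x j) =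
      d i * b ^ 2 + d j * c ^ 2 := by
  rw [eval2_diagonal_frame, Matrix.mulVec_add, Matrix.mulVec_smul, Matrix.mulVec_smul,
    cotetrad_mulVec_tetrad hx, cotetrad_mulVec_tetrad hx]
  have h : ∀ α, d α * (b • Pi.single i (1 : ℝ) + c • Pi.single j 1 : Fin 4 → ℝ) α *
      (b • Pi.single i (1 : ℝ) + c • Pi.single j 1 : Fin 4 → ℝ) α =
      (if α = i then d α * b ^ 2 else 0) + (if α = j then d α * c ^ 2 else 0) := by
    intro α
    by_cases h1 : α = i
    · subst h1
      simp [hij]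
      ring
    · by_cases h2 : α = j
      · subst h2
        simp [h1]
        ring
      · simp [h1, h2]
  rw [Finset.sum_congr rfl fun α _ => h α]
  simp [Finset.sum_add_distrib]

theorem eval2_leg (hx : x ∈ chart m a ℓ) (d : Fin 4 → ℝ) (i : Fin 4) :
    eval2 ((cotetrad m a ℓ x)ᵀ * Matrix.diagonal d * cotetrad m a ℓ x)
      (tetrad m a ℓ x i) (tetrad m a ℓ x i) = d i := by
  rw [eval2_diagonal_frame, cotetrad_mulVec_tetrad hx]
  simp [Pi.single_apply]

/-- The timelike and the spacelike one of the first two legs. -/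
theorem exists_legs (hx : x ∈ chart m a ℓ) :
    ∃ i j : Fin 4, i ≠ j ∧ i ≠ 2 ∧ i ≠ 3 ∧ timeLeg m a ℓ x = tetrad m a ℓ x i ∧
      radialLeg m a ℓ x = tetrad m a ℓ x j ∧ eta m a ℓ x i = -1 ∧ eta m a ℓ x j = 1 ∧
      stressDiag m a ℓ x i = -density m a ℓ x ∧ stressDiag m a ℓ x j = -density m a ℓ x := by
  rcases lt_or_gt_of_ne hx.2.2.2 with h | h
  · exact ⟨1, 0, by decide, by decide, by decide, by simp [timeLeg, h.not_gt],
      by simp [radialLeg, h.not_gt], by simp [eta, Real.sign_of_neg h],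
      by simp [eta, Real.sign_of_neg h], rfl, rfl⟩
  · exact ⟨0, 1, by decide, by decide, by decide, by simp [timeLeg, h],
      by simp [radialLeg, h], by simp [eta, Real.sign_of_pos h],
      by simp [eta, Real.sign_of_pos h], rfl, rfl⟩

theorem rho_eq (hx : x ∈ chart m a ℓ) : rho m a ℓ x = density m a ℓ x := by
  obtain ⟨i, j, -, -, -, h1, -, h2, -, h3, -⟩ := exists_legs hx
  rw [rho, h1, stress_eq hx, eval2_leg hx, h2, h3]
  ring

theorem pr_eq (hx : x ∈ chart m a ℓ) : pr m a ℓ x = -density m a ℓ x := by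
  obtain ⟨i, j, -, -, -, -, h1, -, h2, -, h3⟩ := exists_legs hx
  rw [pr, h1, stress_eq hx, eval2_leg hx, h2, h3]
  ring

theorem pt_eq (hx : x ∈ chart m a ℓ) :
    pt m a ℓ x = density m a ℓ x * (1 - Xi a ℓ x) := by
  rw [pt, stress_eq hx, eval2_leg hx]
  simp [eta, stressDiag]

/-- Both legs have the same mixed component -ρ, so on their plane T is -ρ g and vanishes on null
vectors. -/
theorem radialNEC (hx : x ∈ chart m a ℓ) : RadialNEC m a ℓ x := by
  obtain ⟨i, j, hij, -, -, h1, h2, h3, h4, h5, h6⟩ := exists_legs hx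
  intro b c
  rw [h1, h2, metric_eq_cotetrad hx, stress_eq hx, eval2_plane hx _ hij, eval2_plane hx _ hij, h3,
    h4, h5, h6]
  intro h
  have hc : c ^ 2 = b ^ 2 := by linarith
  rw [hc]
  linarith

theorem transverseNEC_iff (hm : 0 < m) (hℓ : 0 < ℓ) (hx : x ∈ chart m a ℓ) :
    TransverseNEC m a ℓ x ↔ Xi a ℓ x ≤ 2 := by
  obtain ⟨i, j, -, hi2, hi3, h1, -, h3, -, h5, -⟩ := exists_legs hx
  have hd := density_pos (a := a) hm hℓ hx.1
  have e2 : eta m a ℓ x 2 = 1 := rfl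
  have e3 : eta m a ℓ x 3 = 1 := rfl
  have t2 : stressDiag m a ℓ x 2 = density m a ℓ x * (1 - Xi a ℓ x) := rfl
  have t3 : stressDiag m a ℓ x 3 = density m a ℓ x * (1 - Xi a ℓ x) := rfl
  have key : (∀ b c : ℝ, -1 * b ^ 2 + 1 * c ^ 2 = 0 → 0 ≤ -1 * -density m a ℓ x * b ^ 2 +
      1 * (density m a ℓ x * (1 - Xi a ℓ x)) * c ^ 2) ↔ Xi a ℓ x ≤ 2 := by
    constructor
    · intro h
      -- The sum of the timelike and the transverse leg is null, and on it T equals ρ (2 - Ξ).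
      have h' := h 1 1 (by norm_num)
      by_contra! hX
      nlinarith
    · intro hX b c h
      have hc : c ^ 2 = b ^ 2 := by linarith
      rw [hc]
      have : 0 ≤ density m a ℓ x * (2 - Xi a ℓ x) * b ^ 2 := by
        have : 0 ≤ 2 - Xi a ℓ x := by linarith
        positivity
      linarith
  unfold TransverseNEC NullEnergyConditionIn
  rw [h1, metric_eq_cotetrad hx, stress_eq hx]
  simp only [eval2_plane hx _ hi2, eval2_plane hx _ hi3, h3, h5, e2, e3, t2, t3, key, and_self]

theorem NEC_iff (hm : 0 < m) (hℓ : 0 < ℓ) (hx : x ∈ chart m a ℓ) :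
    NEC m a ℓ x ↔ Xi a ℓ x ≤ 2 := by
  constructor
  · intro h
    rw [← transverseNEC_iff hm hℓ hx]
    exact ⟨fun b c => h _, fun b c => h _⟩
  · intro hX k
    have hd := density_pos (a := a) hm hℓ hx.1
    rw [metric_eq_cotetrad hx, stress_eq hx, eval2_diagonal_frame, eval2_diagonal_frame]
    generalize cotetrad m a ℓ x *ᵥ k = w
    simp only [Fin.sum_univ_four, eta, stressDiag, Matrix.cons_val]
    intro h
    -- The null condition trades the part of k along the first two legs for its transverse part;
    -- this works for either sign of Δ.
    have : 0 ≤ density m a ℓ x * (2 - Xi a ℓ x) * (w 2 ^ 2 + w 3 ^ 2) := by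
      have : 0 ≤ 2 - Xi a ℓ x := by linarith
      positivity
    linear_combination this + density m a ℓ x * h

theorem SEC_iff (hm : 0 < m) (hℓ : 0 < ℓ) (hx : x ∈ chart m a ℓ) :
    SEC m a ℓ x ↔ Xi a ℓ x ≤ 1 := by
  have hd := density_pos (a := a) hm hℓ hx.1
  -- The trace of T is -2ρΞ, so subtracting half of it adds ρΞ to each mixed component.
  set u : Fin 4 → ℝ := ![-(density m a ℓ x * (1 - Xi a ℓ x)), -(density m a ℓ x * (1 - Xi a ℓ x)),
    density m a ℓ x, density m a ℓ x] with hu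
  have hT : stress m a ℓ x - (1 / 2 * ∑ μ, ∑ ν, (metric m a ℓ x)⁻¹ μ ν * stress m a ℓ x μ ν) •
      metric m a ℓ x = (cotetrad m a ℓ x)ᵀ * Matrix.diagonal (fun α => eta m a ℓ x α * u α)
        * cotetrad m a ℓ x := by
    rw [stress_eq hx, trace_diagonal hx, metric_eq_cotetrad hx, ← Matrix.smul_mul,
      ← Matrix.mul_smul, ← Matrix.diagonal_smul, ← Matrix.sub_mul, ← Matrix.mul_sub,
      Matrix.diagonal_sub]
    congr 3
    ext α
    fin_cases α <;> simp [Fin.sum_univ_four, stressDiag, hu] <;> ring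
  unfold SEC StrongEnergyCondition
  rw [hT, metric_eq_cotetrad hx]
  constructor
  · intro h
    obtain ⟨i, j, -, -, -, -, -, h3, -, h5, -⟩ := exists_legs hx
    have hui : u i = -(density m a ℓ x * (1 - Xi a ℓ x)) := by
      fin_cases i
      · rfl
      · rfl
      · exact absurd h3 (by norm_num [eta])
      · exact absurd h3 (by norm_num [eta])
    -- The timelike leg is the worst case: the form equals ρ (1 - Ξ) on it.
    have h' := h (tetrad m a ℓ x i)
    rw [eval2_leg hx, eval2_leg hx, h3, hui] at h'
    by_contra! hX
    nlinarith [h' (by norm_num)]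
  · intro hX k
    rw [eval2_diagonal_frame, eval2_diagonal_frame]
    generalize cotetrad m a ℓ x *ᵥ k = w
    simp only [Fin.sum_univ_four, eta, hu, Matrix.cons_val]
    intro h
    -- With q = g(V,V) < 0 and w the transverse part, the form is ρ (1 - Ξ) (-q) + ρ |w|² + ρ (1 -
    -- Ξ) |w|².
    have h1 : 0 ≤ density m a ℓ x * (1 - Xi a ℓ x) := mul_nonneg hd.le (by linarith)
    have h2 := mul_nonneg h1 (neg_nonneg.mpr h.le)
    have h3 : 0 ≤ density m a ℓ x * (w 2 ^ 2 + w 3 ^ 2) := by positivity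
    have h4 : 0 ≤ density m a ℓ x * (1 - Xi a ℓ x) * (w 2 ^ 2 + w 3 ^ 2) := by positivity
    linear_combination h2 + h3 + h4

theorem Xi_equatorial (hr : 0 < x 1) (h : x 2 = π / 2) : Xi a ℓ x = ℓ / (2 * x 1) := by
  rw [Xi, Sig, h, cos_pi_div_two]
  field_simp
  ring

/-- Here Ξ ≤ ℓ (r² + a²) / (2 r³), which decreases in r, and the hypothesis on ℓ says that this
bound is below 1 at r = δ. -/
theorem Xi_le_one_of_le {δ : ℝ} (hδ : 0 < δ) (hℓ : 0 < ℓ) (h : ℓ < 2 * δ ^ 3 / (δ ^ 2 + a ^ 2))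
    (hr : δ ≤ x 1) : Xi a ℓ x ≤ 1 := by
  have hr0 : 0 < x 1 := hδ.trans_le hr
  rw [lt_div_iff₀ (by positivity)] at h
  rw [Xi, div_le_one (by positivity)]
  have h1 : Sig a x ≤ x 1 ^ 2 + a ^ 2 := by
    have := mul_le_mul_of_nonneg_left (cos_sq_le_one (x 2)) (sq_nonneg a)
    rw [Sig]
    linarith
  have h2 : δ ^ 2 * (x 1 ^ 2 + a ^ 2) ≤ x 1 ^ 2 * (δ ^ 2 + a ^ 2) := by
    have := mul_le_mul_of_nonneg_right (pow_le_pow_left₀ hδ.le hr 2) (sq_nonneg a)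
    linarith
  refine le_of_mul_le_mul_left ?_ (pow_pos hδ 2)
  calc δ ^ 2 * (ℓ * Sig a x) = ℓ * (δ ^ 2 * Sig a x) := by ring
    _ ≤ ℓ * (x 1 ^ 2 * (δ ^ 2 + a ^ 2)) := mul_le_mul_of_nonneg_left
        ((mul_le_mul_of_nonneg_left h1 (sq_nonneg δ)).trans h2) hℓ.le
    _ = x 1 ^ 2 * (ℓ * (δ ^ 2 + a ^ 2)) := by ring
    _ ≤ x 1 ^ 2 * (2 * δ ^ 3) := by gcongr
    _ = 2 * x 1 ^ 2 * δ ^ 2 * δ := by ring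
    _ ≤ 2 * x 1 ^ 2 * δ ^ 2 * x 1 := by gcongr
    _ = δ ^ 2 * (2 * x 1 ^ 3) := by ring

/-! Regularity. -/

/-- A single term of the exponential series gives (ℓ/r)^k / k! ≤ e^{ℓ/r}. -/
theorem exp_neg_div_mul_pow_le (hℓ : 0 < ℓ) (k : ℕ) {r : ℝ} (hr : 0 < r) :
    exp (-ℓ / r) * r⁻¹ ^ k ≤ k.factorial / ℓ ^ k := by
  have h := Real.pow_div_factorial_le_exp (ℓ / r) (by positivity) k
  rw [div_le_iff₀ (by positivity)] at h
  rw [le_div_iff₀ (by positivity), neg_div, exp_neg]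
  calc (exp (ℓ / r))⁻¹ * r⁻¹ ^ k * ℓ ^ k = (exp (ℓ / r))⁻¹ * (ℓ / r) ^ k := by
        rw [div_eq_mul_inv, mul_pow]
        ring
    _ ≤ (exp (ℓ / r))⁻¹ * (exp (ℓ / r) * k.factorial) := by gcongr
    _ = k.factorial := by rw [← mul_assoc, inv_mul_cancel₀ (exp_pos _).ne', one_mul]

/-- The exponent k yields boundedness. The exponent k + 1 leaves a factor r to spare, which yields
decay as r → 0; adding the two constants serves both. -/
theorem exists_massFn_mul_pow_le (hm : 0 < m) (hℓ : 0 < ℓ) (k : ℕ) :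
    ∃ K, 0 < K ∧ ∀ r, 0 < r → massFn m ℓ r * r⁻¹ ^ k ≤ K ∧ massFn m ℓ r * r⁻¹ ^ k ≤ K * r := by
  refine ⟨m * (k.factorial / ℓ ^ k + (k + 1).factorial / ℓ ^ (k + 1)), by positivity,
    fun r hr => ?_⟩
  have h1 := exp_neg_div_mul_pow_le hℓ k hr
  have h2 := exp_neg_div_mul_pow_le hℓ (k + 1) hr
  have h3 : (0 : ℝ) ≤ k.factorial / ℓ ^ k := by positivity
  have h4 : (0 : ℝ) ≤ (k + 1).factorial / ℓ ^ (k + 1) := by positivity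
  have h5 : exp (-ℓ / r) * r⁻¹ ^ k = exp (-ℓ / r) * r⁻¹ ^ (k + 1) * r := by
    rw [pow_succ, mul_assoc, mul_assoc, inv_mul_cancel₀ hr.ne', mul_one]
  unfold massFn
  constructor
  · rw [mul_assoc]
    exact mul_le_mul_of_nonneg_left (by linarith) hm.le
  · rw [mul_assoc, mul_assoc, h5]
    exact mul_le_mul_of_nonneg_left (mul_le_mul_of_nonneg_right (by linarith) hr.le) hm.le

/-- A bound for all curvature components. -/
def curvatureBound (m ℓ r : ℝ) : ℝ :=
  massFn m ℓ r * (10 * (ℓ ^ 2 * r⁻¹ ^ 5 + ℓ * r⁻¹ ^ 4 + r⁻¹ ^ 3))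

theorem exists_curvatureBound_le (hm : 0 < m) (hℓ : 0 < ℓ) :
    ∃ K, 0 < K ∧ ∀ r, 0 < r → curvatureBound m ℓ r ≤ K ∧ curvatureBound m ℓ r ≤ K * r := by
  obtain ⟨K₅, h₅, H₅⟩ := exists_massFn_mul_pow_le hm hℓ 5
  obtain ⟨K₄, h₄, H₄⟩ := exists_massFn_mul_pow_le hm hℓ 4
  obtain ⟨K₃, h₃, H₃⟩ := exists_massFn_mul_pow_le hm hℓ 3
  refine ⟨10 * (ℓ ^ 2 * K₅ + ℓ * K₄ + K₃), by positivity, fun r hr => ?_⟩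
  have e : curvatureBound m ℓ r = 10 * (ℓ ^ 2 * (massFn m ℓ r * r⁻¹ ^ 5)
      + ℓ * (massFn m ℓ r * r⁻¹ ^ 4) + massFn m ℓ r * r⁻¹ ^ 3) := by
    unfold curvatureBound
    ring
  rw [e]
  constructor
  · gcongr
    exacts [(H₅ r hr).1, (H₄ r hr).1, (H₃ r hr).1]
  · have h5 := mul_le_mul_of_nonneg_left (H₅ r hr).2 (sq_nonneg ℓ)
    have h4 := mul_le_mul_of_nonneg_left (H₄ r hr).2 hℓ.le
    have h3 := (H₃ r hr).2
    linarith

theorem massFn_pos (hm : 0 < m) (r : ℝ) : 0 < massFn m ℓ r := mul_pos hm (exp_pos _)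

theorem inv_Sig_le (hr : 0 < x 1) : (Sig a x)⁻¹ ≤ (x 1)⁻¹ ^ 2 := by
  rw [inv_pow]
  refine inv_anti₀ (by positivity) ?_
  rw [Sig]
  nlinarith [mul_nonneg (sq_nonneg a) (sq_nonneg (cos (x 2)))]

/-- The curvature components are combinations of terms each of which is bounded as follows. -/
theorem term_bounds (hm : 0 < m) (hℓ : 0 < ℓ) (hr : 0 < x 1) :
    0 ≤ massFn m ℓ (x 1) * (ℓ ^ 2 * (x 1)⁻¹ ^ 3 * (Sig a x)⁻¹) ∧
    massFn m ℓ (x 1) * (ℓ ^ 2 * (x 1)⁻¹ ^ 3 * (Sig a x)⁻¹) ≤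
      massFn m ℓ (x 1) * (ℓ ^ 2 * (x 1)⁻¹ ^ 5) ∧
    0 ≤ massFn m ℓ (x 1) * (ℓ * (Sig a x)⁻¹ ^ 2) ∧
    massFn m ℓ (x 1) * (ℓ * (Sig a x)⁻¹ ^ 2) ≤ massFn m ℓ (x 1) * (ℓ * (x 1)⁻¹ ^ 4) ∧
    |massFn m ℓ (x 1) * (x 1 * (x 1 ^ 2 - 3 * a ^ 2 * cos (x 2) ^ 2) * (Sig a x)⁻¹ ^ 3)| ≤
      massFn m ℓ (x 1) * (3 * (x 1)⁻¹ ^ 3) := by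
  have hM := (massFn_pos (ℓ := ℓ) hm (x 1)).le
  have hS := Sig_pos (a := a) hr
  have hi := inv_Sig_le (a := a) hr
  have hi2 : (Sig a x)⁻¹ ^ 2 ≤ (x 1)⁻¹ ^ 4 := by
    calc (Sig a x)⁻¹ ^ 2 ≤ ((x 1)⁻¹ ^ 2) ^ 2 := by gcongr
      _ = _ := by ring
  refine ⟨by positivity, ?_, by positivity, by gcongr, ?_⟩
  · refine mul_le_mul_of_nonneg_left ?_ hM
    calc ℓ ^ 2 * (x 1)⁻¹ ^ 3 * (Sig a x)⁻¹ ≤ ℓ ^ 2 * (x 1)⁻¹ ^ 3 * (x 1)⁻¹ ^ 2 := by gcongr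
      _ = _ := by ring
  · rw [abs_mul, abs_of_nonneg hM]
    gcongr
    have h1 : |x 1 ^ 2 - 3 * a ^ 2 * cos (x 2) ^ 2| ≤ 3 * Sig a x := by
      have h2 := mul_nonneg (sq_nonneg a) (sq_nonneg (cos (x 2)))
      rw [abs_le, Sig]
      constructor <;> nlinarith [sq_nonneg (x 1)]
    rw [abs_mul, abs_mul, abs_of_pos hr, abs_of_pos (pow_pos (inv_pos.mpr hS) 3)]
    calc x 1 * |x 1 ^ 2 - 3 * a ^ 2 * cos (x 2) ^ 2| * (Sig a x)⁻¹ ^ 3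
        ≤ x 1 * (3 * Sig a x) * (Sig a x)⁻¹ ^ 3 := by gcongr
      _ = 3 * (x 1 * (Sig a x)⁻¹ ^ 2) := by field_simp
      _ ≤ 3 * (x 1 * (x 1)⁻¹ ^ 4) := by gcongr
      _ = _ := by field_simp

theorem curvatureBound_eq (m ℓ r : ℝ) : curvatureBound m ℓ r =
    10 * (massFn m ℓ r * (ℓ ^ 2 * r⁻¹ ^ 5)) + 10 * (massFn m ℓ r * (ℓ * r⁻¹ ^ 4))
      + 10 * (massFn m ℓ r * r⁻¹ ^ 3) := by
  unfold curvatureBound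
  ring

/-- The prefactor is absorbed by |2 a cos θ · r| ≤ Σ, the inequality of arithmetic and geometric
means; no bound in terms of a is needed. -/
theorem two_mul_kD_le (hm : 0 < m) (hℓ : 0 < ℓ) (hx : x ∈ chart m a ℓ) :
    |2 * (jet m a ℓ x).kD| ≤ curvatureBound m ℓ (x 1) := by
  have hr := hx.1
  have hS := Sig_pos (a := a) hr
  have hM := massFn_pos (ℓ := ℓ) hm (x 1)
  have p5 : 0 ≤ massFn m ℓ (x 1) * (ℓ ^ 2 * (x 1)⁻¹ ^ 5) := by positivity
  have p4 : 0 ≤ massFn m ℓ (x 1) * (ℓ * (x 1)⁻¹ ^ 4) := by positivity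
  have p3 : 0 ≤ massFn m ℓ (x 1) * ((x 1)⁻¹ ^ 3) := by positivity
  have eD : 2 * (jet m a ℓ x).kD = 2 * (a * cos (x 2) * x 1) * (massFn m ℓ (x 1) *
      (ℓ * (x 1)⁻¹ ^ 2 * (Sig a x)⁻¹ ^ 2 +
        (x 1)⁻¹ * (a ^ 2 * cos (x 2) ^ 2 - 3 * x 1 ^ 2) * (Sig a x)⁻¹ ^ 3)) := by
    rw [kD_eq hx, Xi]
    field_simp
    ring
  have h1 : |2 * (a * cos (x 2) * x 1)| ≤ Sig a x := by
    rw [Sig, abs_le]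
    constructor <;> nlinarith [sq_nonneg (a * cos (x 2) + x 1), sq_nonneg (a * cos (x 2) - x 1)]
  have h2 : |a ^ 2 * cos (x 2) ^ 2 - 3 * x 1 ^ 2| ≤ 3 * Sig a x := by
    have h2 := mul_nonneg (sq_nonneg a) (sq_nonneg (cos (x 2)))
    rw [abs_le, Sig]
    constructor <;> nlinarith [sq_nonneg (x 1)]
  have hi := inv_Sig_le (a := a) hr
  have hbound := curvatureBound_eq m ℓ (x 1)
  rw [eD, abs_mul, abs_mul (massFn m ℓ (x 1)), abs_of_pos hM]
  calc |2 * (a * cos (x 2) * x 1)| * (massFn m ℓ (x 1) * |ℓ * (x 1)⁻¹ ^ 2 * (Sig a x)⁻¹ ^ 2 +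
        (x 1)⁻¹ * (a ^ 2 * cos (x 2) ^ 2 - 3 * x 1 ^ 2) * (Sig a x)⁻¹ ^ 3|)
      ≤ Sig a x * (massFn m ℓ (x 1) * (ℓ * (x 1)⁻¹ ^ 2 * (Sig a x)⁻¹ ^ 2 +
        (x 1)⁻¹ * (3 * Sig a x) * (Sig a x)⁻¹ ^ 3)) := by
        gcongr
        refine (abs_add_le _ _).trans ?_
        rw [abs_of_pos (by positivity : 0 < ℓ * (x 1)⁻¹ ^ 2 * (Sig a x)⁻¹ ^ 2), abs_mul, abs_mul,
          abs_of_pos (inv_pos.mpr hr), abs_of_pos (pow_pos (inv_pos.mpr hS) 3)]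
        gcongr
    _ = massFn m ℓ (x 1) * (ℓ * (x 1)⁻¹ ^ 2 * (Sig a x)⁻¹ + 3 * (x 1)⁻¹ * (Sig a x)⁻¹) := by
        field_simp
    _ ≤ massFn m ℓ (x 1) * (ℓ * (x 1)⁻¹ ^ 2 * (x 1)⁻¹ ^ 2 + 3 * (x 1)⁻¹ * (x 1)⁻¹ ^ 2) := by
        gcongr
    _ = massFn m ℓ (x 1) * (ℓ * (x 1)⁻¹ ^ 4) + 3 * (massFn m ℓ (x 1) * (x 1)⁻¹ ^ 3) := by ring
    _ ≤ _ := by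
        rw [hbound]
        linarith

theorem curvature_le (hm : 0 < m) (hℓ : 0 < ℓ) (hx : x ∈ chart m a ℓ) :
    |(jet m a ℓ x).kA| ≤ curvatureBound m ℓ (x 1) ∧ |(jet m a ℓ x).kB| ≤ curvatureBound m ℓ (x 1) ∧
    |(jet m a ℓ x).kC| ≤ curvatureBound m ℓ (x 1) ∧
    |2 * (jet m a ℓ x).kD| ≤ curvatureBound m ℓ (x 1) := by
  have hr := hx.1
  have hS := Sig_pos (a := a) hr
  have hM := massFn_pos (ℓ := ℓ) hm (x 1)
  obtain ⟨b1, b2, b3, b4, b5⟩ := term_bounds (a := a) hm hℓ hr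
  obtain ⟨b6, b7⟩ := abs_le.mp b5
  have p5 : 0 ≤ massFn m ℓ (x 1) * (ℓ ^ 2 * (x 1)⁻¹ ^ 5) := by positivity
  have p4 : 0 ≤ massFn m ℓ (x 1) * (ℓ * (x 1)⁻¹ ^ 4) := by positivity
  have p3 : 0 ≤ massFn m ℓ (x 1) * ((x 1)⁻¹ ^ 3) := by positivity
  have eA : (jet m a ℓ x).kA = massFn m ℓ (x 1) * (ℓ ^ 2 * (x 1)⁻¹ ^ 3 * (Sig a x)⁻¹)
      - 4 * (massFn m ℓ (x 1) * (ℓ * (Sig a x)⁻¹ ^ 2))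
      + 2 * (massFn m ℓ (x 1) * (x 1 * (x 1 ^ 2 - 3 * a ^ 2 * cos (x 2) ^ 2) * (Sig a x)⁻¹ ^ 3)) := by
    rw [kA_eq hx, Xi]
    field_simp
    ring
  have eB : (jet m a ℓ x).kB =
      2 * (massFn m ℓ (x 1) * (x 1 * (x 1 ^ 2 - 3 * a ^ 2 * cos (x 2) ^ 2) * (Sig a x)⁻¹ ^ 3)) := by
    rw [kB_eq hx]
    field_simp
  have eC : (jet m a ℓ x).kC = massFn m ℓ (x 1) * (ℓ * (Sig a x)⁻¹ ^ 2)
      - massFn m ℓ (x 1) * (x 1 * (x 1 ^ 2 - 3 * a ^ 2 * cos (x 2) ^ 2) * (Sig a x)⁻¹ ^ 3) := by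
    rw [kC_eq hx, Xi]
    field_simp
    ring
  have hbound := curvatureBound_eq m ℓ (x 1)
  have b8 : massFn m ℓ (x 1) * (3 * (x 1)⁻¹ ^ 3) = 3 * (massFn m ℓ (x 1) * (x 1)⁻¹ ^ 3) := by ring
  rw [b8] at b6 b7
  refine ⟨?_, ?_, ?_, ?_⟩
  · rw [eA, hbound, abs_le]
    constructor <;> linarith
  · rw [eB, hbound, abs_le]
    constructor <;> linarith
  · rw [eC, hbound, abs_le]
    constructor <;> linarith
  · exact two_mul_kD_le hm hℓ hx

/-- Each entry of the table is one of eleven functions of its five arguments. The predicate is on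
functions, not values, so that what is chosen in it may depend on the indices alone. -/
theorem riemannTable_induction {P : (ℝ → ℝ → ℝ → ℝ → ℝ → ℝ) → Prop}
    (h0 : P fun _ _ _ _ _ => 0)
    (hA : P fun A _ _ _ _ => A) (hA' : P fun A _ _ _ _ => -A)
    (hB : P fun _ B _ _ _ => B) (hB' : P fun _ B _ _ _ => -B)
    (hC : P fun _ _ C _ _ => C) (hC' : P fun _ _ C _ _ => -C)
    (hD : P fun _ _ _ D _ => 2 * D) (hD' : P fun _ _ _ D _ => -(2 * D))
    (hs : P fun _ _ _ D s => s * D) (hs' : P fun _ _ _ D s => -(s * D)) (α β μ ν : Fin 4) :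
    P fun A B C D s => riemannTable A B C D s μ ν α β := by
  fin_cases μ <;> fin_cases ν <;> fin_cases α <;> fin_cases β <;>
    first
    | exact h0
    | exact hA
    | exact hA'
    | exact hB
    | exact hB'
    | exact hC
    | exact hC'
    | exact hD
    | exact hD'
    | exact hs
    | exact hs'

theorem riemannTable_le {A B C D s K : ℝ} (hs : s = 1 ∨ s = -1) (hA : |A| ≤ K) (hB : |B| ≤ K)
    (hC : |C| ≤ K) (hD : |2 * D| ≤ K) (α β μ ν : Fin 4) :
    |riemannTable A B C D s μ ν α β| ≤ K := by
  have hK : 0 ≤ K := (abs_nonneg A).trans hA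
  have hD' : |D| ≤ K := by
    rw [abs_mul, abs_two] at hD
    linarith [abs_nonneg D]
  have hs' : |s * D| ≤ K := by
    rcases hs with rfl | rfl <;> simpa using hD'
  exact riemannTable_induction (P := fun f => |f A B C D s| ≤ K) (by rwa [abs_zero]) hA
    (by rwa [abs_neg]) hB (by rwa [abs_neg]) hC (by rwa [abs_neg]) hD (by rwa [abs_neg]) hs'
    (by rwa [abs_neg]) α β μ ν

theorem orthoRiemann_le (hm : 0 < m) (hℓ : 0 < ℓ) (hx : x ∈ chart m a ℓ) (α β μ ν : Fin 4) :
    |orthoRiemann m a ℓ x α β μ ν| ≤ curvatureBound m ℓ (x 1) := by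
  obtain ⟨hA, hB, hC, hD⟩ := curvature_le hm hℓ hx
  rw [orthoRiemann_eq hx]
  exact riemannTable_le (sign_eq_one_or hx.2.2.2) hA hB hC hD α β μ ν

theorem density_le (hm : 0 < m) (hℓ : 0 < ℓ) (hx : x ∈ chart m a ℓ) :
    density m a ℓ x ≤ curvatureBound m ℓ (x 1) ∧
      |density m a ℓ x * (1 - Xi a ℓ x)| ≤ curvatureBound m ℓ (x 1) := by
  have hr := hx.1
  have hS := Sig_pos (a := a) hr
  have hM := massFn_pos (ℓ := ℓ) hm (x 1)
  obtain ⟨b1, b2, b3, b4, -⟩ := term_bounds (a := a) hm hℓ hr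
  have p5 : 0 ≤ massFn m ℓ (x 1) * (ℓ ^ 2 * (x 1)⁻¹ ^ 5) := by positivity
  have p4 : 0 ≤ massFn m ℓ (x 1) * (ℓ * (x 1)⁻¹ ^ 4) := by positivity
  have p3 : 0 ≤ massFn m ℓ (x 1) * ((x 1)⁻¹ ^ 3) := by positivity
  have hpi : (4 * π)⁻¹ ≤ 1 := inv_le_one_of_one_le₀ (by linarith [pi_gt_three])
  have hpi0 : 0 < (4 * π)⁻¹ := by positivity
  have e1 : density m a ℓ x = (4 * π)⁻¹ * (massFn m ℓ (x 1) * (ℓ * (Sig a x)⁻¹ ^ 2)) := by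
    rw [density, massFn]
    field_simp
  have e2 : density m a ℓ x * Xi a ℓ x =
      (4 * π)⁻¹ * (massFn m ℓ (x 1) * (ℓ ^ 2 * (x 1)⁻¹ ^ 3 * (Sig a x)⁻¹)) / 2 := by
    rw [density, massFn, Xi]
    field_simp
  have i1 := mul_le_of_le_one_left b3 hpi
  have i2 := mul_le_of_le_one_left b1 hpi
  have i3 := mul_nonneg hpi0.le b3
  have i4 := mul_nonneg hpi0.le b1
  have hbound := curvatureBound_eq m ℓ (x 1)
  constructor
  · rw [e1, hbound]
    linarith
  · rw [mul_sub, mul_one, e1, ← e1, e2, e1, hbound, abs_le]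
    constructor <;> linarith

theorem curvatureRegular (hm : 0 < m) (hℓ : 0 < ℓ) : CurvatureRegular m a ℓ := by
  obtain ⟨K, -, hK⟩ := exists_curvatureBound_le hm hℓ
  exact ⟨K, fun x hx α β μ ν => (orthoRiemann_le hm hℓ hx α β μ ν).trans (hK _ hx.1).1⟩

theorem asymptoticallyMinkowskiCore (hm : 0 < m) (hℓ : 0 < ℓ) :
    AsymptoticallyMinkowskiCore m a ℓ := by
  obtain ⟨K, hK0, hK⟩ := exists_curvatureBound_le hm hℓ
  intro ε hε
  refine ⟨ε / K, by positivity, fun x hx hxδ => ?_⟩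
  have h : curvatureBound m ℓ (x 1) < ε := by
    rw [lt_div_iff₀ hK0] at hxδ
    linarith [(hK _ hx.1).2]
  obtain ⟨h1, h2⟩ := density_le hm hℓ hx
  have hd := density_pos (a := a) hm hℓ hx.1
  refine ⟨fun α β μ ν => (orthoRiemann_le hm hℓ hx α β μ ν).trans_lt h, ?_, ?_, ?_⟩
  · rw [rho_eq hx, abs_of_pos hd]
    exact h1.trans_lt h
  · rw [pr_eq hx, abs_neg, abs_of_pos hd]
    exact h1.trans_lt h
  · rw [pt_eq hx]
    exact h2.trans_lt h

theorem massFn_isLittleO (hm : 0 < m) (hℓ : 0 < ℓ) :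
    massFn m ℓ =o[𝓝[>] 0] fun r : ℝ => r ^ 3 := by
  obtain ⟨K, hK0, hK⟩ := exists_massFn_mul_pow_le hm hℓ 3
  rw [Asymptotics.isLittleO_iff]
  intro c hc
  have h1 : ∀ᶠ r : ℝ in 𝓝[>] 0, r < c / K :=
    nhdsWithin_le_nhds (Iio_mem_nhds (div_pos hc hK0))
  filter_upwards [h1, self_mem_nhdsWithin] with r hr hr0
  have hr0' : 0 < r := hr0
  rw [lt_div_iff₀ hK0] at hr
  have h := (hK r hr0').2
  rw [inv_pow, ← div_eq_mul_inv, div_le_iff₀ (by positivity)] at h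
  rw [norm_of_nonneg (massFn_pos hm r).le, norm_of_nonneg (by positivity)]
  refine h.trans (mul_le_mul_of_nonneg_right ?_ (by positivity))
  linarith

/-! The form of the components. -/

theorem riemannTable_form (α β μ ν : Fin 4) : ∃ (q : ℝ) (k : ℕ) (i : Fin 4), ∀ A B C D s : ℝ,
    riemannTable A B C D s μ ν α β = s ^ k * (q * ![A, B, C, D] i) :=
  riemannTable_induction (P := fun f => ∃ (q : ℝ) (k : ℕ) (i : Fin 4), ∀ A B C D s : ℝ,
      f A B C D s = s ^ k * (q * ![A, B, C, D] i))
    ⟨0, 0, 0, by simp⟩ ⟨1, 0, 0, by simp⟩ ⟨-1, 0, 0, by simp⟩ ⟨1, 0, 1, by simp⟩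
    ⟨-1, 0, 1, by simp⟩ ⟨1, 0, 2, by simp⟩ ⟨-1, 0, 2, by simp⟩ ⟨2, 0, 3, by simp⟩
    ⟨-2, 0, 3, by simp⟩ ⟨1, 1, 3, by simp⟩ ⟨-1, 1, 3, by simp⟩ α β μ ν

open MvPolynomial in
/-- The polynomials in `r, cos θ, a, ℓ` in the numerators of the curvature components. -/
def curvaturePoly : Fin 4 → MvPolynomial (Fin 4) ℝ :=
  ![X 3 ^ 2 * (X 0 ^ 2 + X 2 ^ 2 * X 1 ^ 2) ^ 2 - 4 * X 3 * (X 0 ^ 2 + X 2 ^ 2 * X 1 ^ 2) * X 0 ^ 3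
      + 2 * X 0 ^ 6 - 6 * X 2 ^ 2 * X 1 ^ 2 * X 0 ^ 4,
    2 * X 0 ^ 3 - 6 * X 2 ^ 2 * X 1 ^ 2 * X 0,
    X 3 * (X 0 ^ 2 + X 2 ^ 2 * X 1 ^ 2) + 3 * X 2 ^ 2 * X 1 ^ 2 * X 0 - X 0 ^ 3,
    X 2 * X 1 * (X 3 * (X 0 ^ 2 + X 2 ^ 2 * X 1 ^ 2) + X 2 ^ 2 * X 1 ^ 2 * X 0 - 3 * X 0 ^ 3)]

/-- The powers 3, 0, 0, 1 of r clear the denominators that Ξ = ℓ Σ / (2 r³) and a / r leave after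
the prefactors r³ and r² are used up. -/
theorem curvature_eq_poly (hx : x ∈ chart m a ℓ) (i : Fin 4) :
    ![(jet m a ℓ x).kA, (jet m a ℓ x).kB, (jet m a ℓ x).kC, (jet m a ℓ x).kD] i =
      m * exp (-ℓ / x 1) * MvPolynomial.eval ![x 1, cos (x 2), a, ℓ] (curvaturePoly i) /
        (x 1 ^ (![3, 0, 0, 1] i : ℕ) * Sig a x ^ 3) := by
  have hr := hx.1.ne'
  have hS := (Sig_pos (a := a) hx.1).ne'
  have h : x 1 ^ 2 + a ^ 2 * cos (x 2) ^ 2 = Sig a x := rfl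
  fin_cases i <;> simp [curvaturePoly, kA_eq hx, kB_eq hx, kC_eq hx, kD_eq hx, massFn, Xi, h] <;>
    field_simp <;> ring

theorem orthoRiemann_form (α β μ ν : Fin 4) : ∃ (n k : ℕ) (X : MvPolynomial (Fin 4) ℝ),
    ∀ m a ℓ : ℝ, 0 < m → 0 < ℓ → ∀ x ∈ chart m a ℓ,
      orthoRiemann m a ℓ x α β μ ν = Real.sign (Del m a ℓ x) ^ k *
        (m * exp (-ℓ / x 1) * MvPolynomial.eval ![x 1, cos (x 2), a, ℓ] X /
          (x 1 ^ n * Sig a x ^ 3)) := by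
  obtain ⟨q, k, i, h⟩ := riemannTable_form α β μ ν
  refine ⟨![3, 0, 0, 1] i, k, MvPolynomial.C q * curvaturePoly i, fun m a ℓ _ _ x hx => ?_⟩
  rw [orthoRiemann_eq hx, h, curvature_eq_poly hx, map_mul, MvPolynomial.eval_C]
  ring

/-! ### Symmetries and zeros of the table. -/

-- The signs `e` convert mixed components to components of one type, for which pair exchange is a
-- symmetry. The case split on s provides s² = 1.
set_option maxHeartbeats 2000000 in
theorem riemannTable_pair_symm {s : ℝ} (hs : s = 1 ∨ s = -1) (A B C D : ℝ) {e : Fin 4 → ℝ}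
    (he : e = ![-s, s, 1, 1]) (α β μ ν : Fin 4) :
    e α * e β * riemannTable A B C D s μ ν α β = e μ * e ν * riemannTable A B C D s α β μ ν := by
  subst he
  rcases hs with rfl | rfl <;>
  fin_cases μ <;> fin_cases ν <;> fin_cases α <;> fin_cases β <;> simp [riemannTable]

set_option maxHeartbeats 1000000 in
theorem riemannTable_antisymm (A B C D s : ℝ) (α β μ ν : Fin 4) :
    riemannTable A B C D s μ ν β α = -riemannTable A B C D s μ ν α β := by
  fin_cases μ <;> fin_cases ν <;> fin_cases α <;> fin_cases β <;> simp [riemannTable]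

/-- An index pair couples only to itself and to the complementary pair. -/
theorem riemannTable_eq_zero (A B C D s : ℝ) (α β μ ν : Fin 4)
    (h1 : ({α, β} : Finset (Fin 4)) ≠ {μ, ν})
    (h2 : ({α, β, μ, ν} : Finset (Fin 4)) ≠ Finset.univ) :
    riemannTable A B C D s μ ν α β = 0 := by
  revert h1 h2
  fin_cases μ <;> fin_cases ν <;> fin_cases α <;> fin_cases β <;> intro h1 h2 <;>
    first
    | rfl
    | exact absurd (by decide) h1
    | exact absurd (by decide) h2

end EyeOfStorm

end

theorem mainTheorem5 :
    -- every orthonormal Riemann component has the form `m e^{-ℓ/r} X / (r^n Σ³)`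
    (∀ α β μ ν : Fin 4, ∃ (n k : ℕ) (X : MvPolynomial (Fin 4) ℝ),
      ∀ m a ℓ : ℝ, 0 < m → 0 < ℓ → ∀ x ∈ chart m a ℓ,
        orthoRiemann m a ℓ x α β μ ν =
          Real.sign (Del m a ℓ x) ^ k *
            (m * exp (-ℓ / x 1) * MvPolynomial.eval ![x 1, cos (x 2), a, ℓ] X /
              (x 1 ^ n * Sig a x ^ 3))) ∧
    (∀ m a ℓ : ℝ, 0 < m → 0 < ℓ →
      CurvatureRegular m a ℓ ∧
      AsymptoticallyMinkowskiCore m a ℓ ∧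
      (massFn m ℓ =o[𝓝[>] 0] fun r : ℝ => r ^ 3) ∧
      ∀ x ∈ chart m a ℓ,
        -- the tetrad is orthonormal and dual to the co-tetrad
        ((∀ μ ν : Fin 4, metric m a ℓ x μ ν =
            ∑ α, eta m a ℓ x α * cotetrad m a ℓ x α μ * cotetrad m a ℓ x α ν) ∧
          (∀ α β : Fin 4, ∑ μ, cotetrad m a ℓ x α μ * tetrad m a ℓ x β μ =
            if α = β then 1 else 0)) ∧
        -- symmetries of the orthonormal Riemann components
        ((∀ α β μ ν : Fin 4,
            orthoRiemann m a ℓ x β α μ ν = -orthoRiemann m a ℓ x α β μ ν ∧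
            orthoRiemann m a ℓ x α β ν μ = -orthoRiemann m a ℓ x α β μ ν ∧
            eta m a ℓ x α * eta m a ℓ x β * orthoRiemann m a ℓ x α β μ ν =
              eta m a ℓ x μ * eta m a ℓ x ν * orthoRiemann m a ℓ x μ ν α β) ∧
        -- the nonzero ones up to these symmetries
          orthoRiemann m a ℓ x 0 1 0 1 =
            2 * x 1 ^ 3 * massFn m ℓ (x 1) / Sig a x ^ 3 *
              (2 * Xi a ℓ x ^ 2 - 4 * Xi a ℓ x + 1 - 3 * (a / x 1) ^ 2 * cos (x 2) ^ 2) ∧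
          (-(1 / 2) * orthoRiemann m a ℓ x 0 1 2 3 =
              a * cos (x 2) * x 1 ^ 2 * massFn m ℓ (x 1) / Sig a x ^ 3 *
                (2 * Xi a ℓ x + (a / x 1) ^ 2 * cos (x 2) ^ 2 - 3) ∧
            -orthoRiemann m a ℓ x 0 2 1 3 = Real.sign (Del m a ℓ x) *
              (a * cos (x 2) * x 1 ^ 2 * massFn m ℓ (x 1) / Sig a x ^ 3 *
                (2 * Xi a ℓ x + (a / x 1) ^ 2 * cos (x 2) ^ 2 - 3)) ∧
            orthoRiemann m a ℓ x 0 3 1 2 = Real.sign (Del m a ℓ x) *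
              (a * cos (x 2) * x 1 ^ 2 * massFn m ℓ (x 1) / Sig a x ^ 3 *
                (2 * Xi a ℓ x + (a / x 1) ^ 2 * cos (x 2) ^ 2 - 3))) ∧
          (∀ α β : Fin 4, (α = 0 ∨ α = 1) → (β = 2 ∨ β = 3) →
            orthoRiemann m a ℓ x α β α β =
              x 1 ^ 3 * massFn m ℓ (x 1) / Sig a x ^ 3 *
                (2 * Xi a ℓ x + 3 * (a / x 1) ^ 2 * cos (x 2) ^ 2 - 1)) ∧
          orthoRiemann m a ℓ x 2 3 2 3 =
            2 * x 1 ^ 3 * massFn m ℓ (x 1) / Sig a x ^ 3 *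
              (1 - 3 * (a / x 1) ^ 2 * cos (x 2) ^ 2) ∧
        -- all others vanish
          (∀ α β μ ν : Fin 4, ({α, β} : Finset (Fin 4)) ≠ {μ, ν} →
            ({α, β, μ, ν} : Finset (Fin 4)) ≠ Finset.univ → orthoRiemann m a ℓ x α β μ ν = 0)) ∧
        -- the Einstein tensor
        (∀ α β : Fin 4, orthoEinstein m a ℓ x α β =
          -(2 * ℓ * m * exp (-ℓ / x 1) / Sig a x ^ 2) *
            Matrix.diagonal ![1, 1, Xi a ℓ x - 1, Xi a ℓ x - 1] α β) ∧
        -- the stress-energy tensor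
        (∀ α β : Fin 4, orthoMixed m a ℓ x (stress m a ℓ x) α β =
          Matrix.diagonal ![-rho m a ℓ x, pr m a ℓ x, pt m a ℓ x, pt m a ℓ x] α β) ∧
        rho m a ℓ x = ℓ * m * exp (-ℓ / x 1) / (4 * π * Sig a x ^ 2) ∧
        rho m a ℓ x = -pr m a ℓ x ∧
        0 < rho m a ℓ x ∧
        pt m a ℓ x = ℓ * m * exp (-ℓ / x 1) / (4 * π * Sig a x ^ 2) * (1 - Xi a ℓ x) ∧
        -- the energy conditions
        RadialNEC m a ℓ x ∧
        (¬ TransverseNEC m a ℓ x ↔ rho m a ℓ x + pt m a ℓ x < 0) ∧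
        (¬ TransverseNEC m a ℓ x ↔ 2 < Xi a ℓ x) ∧
        (¬ NEC m a ℓ x ↔ 2 < Xi a ℓ x) ∧
        (¬ SEC m a ℓ x ↔ rho m a ℓ x + pr m a ℓ x + 2 * pt m a ℓ x < 0) ∧
        (¬ SEC m a ℓ x ↔ 1 < Xi a ℓ x) ∧
        -- on the equatorial plane
        (x 2 = π / 2 →
          (¬ TransverseNEC m a ℓ x ↔ x 1 < ℓ / 4) ∧ (¬ SEC m a ℓ x ↔ x 1 < ℓ / 2))) ∧
    -- small `ℓ` confines all violations of the energy conditions to the deep core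
    (∀ a δ : ℝ, 0 < δ → ∃ ℓ₀ > 0, ∀ m ℓ : ℝ, 0 < m → 0 < ℓ → ℓ < ℓ₀ →
      ∀ x ∈ chart m a ℓ, (¬ NEC m a ℓ x ∨ ¬ SEC m a ℓ x) → x 1 < δ) := by
  refine ⟨orthoRiemann_form, fun m a ℓ hm hℓ => ⟨curvatureRegular hm hℓ,
    asymptoticallyMinkowskiCore hm hℓ, massFn_isLittleO hm hℓ, fun x hx => ?_⟩, ?_⟩
  · have hd := density_pos (a := a) hm hℓ hx.1
    have hs := sign_eq_one_or hx.2.2.2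
    have hsum : rho m a ℓ x + pr m a ℓ x + 2 * pt m a ℓ x =
        density m a ℓ x * (2 * (1 - Xi a ℓ x)) := by
      rw [rho_eq hx, pr_eq hx, pt_eq hx]
      ring
    have hsum' : rho m a ℓ x + pt m a ℓ x = density m a ℓ x * (2 - Xi a ℓ x) := by
      rw [rho_eq hx, pt_eq hx]
      ring
    have hT : ¬ TransverseNEC m a ℓ x ↔ 2 < Xi a ℓ x := by
      rw [transverseNEC_iff hm hℓ hx, not_le]
    have hSEC : ¬ SEC m a ℓ x ↔ 1 < Xi a ℓ x := by
      rw [SEC_iff hm hℓ hx, not_le]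
    refine ⟨⟨fun μ ν => ?_, fun α β => ?_⟩, ⟨fun α β μ ν => ⟨?_, ?_, ?_⟩, ?_, ⟨?_, ?_, ?_⟩, ?_, ?_,
      fun α β μ ν h1 h2 => ?_⟩, fun α β => ?_, fun α β => ?_, rho_eq hx, ?_, ?_, pt_eq hx,
      radialNEC hx, ?_, hT, ?_, ?_, hSEC, fun h => ?_⟩
    · rw [metric_eq_cotetrad hx, Matrix.mul_apply]
      refine Finset.sum_congr rfl fun α _ => ?_
      rw [Matrix.mul_diagonal, Matrix.transpose_apply]
      ring
    · have h := congrFun (congrFun (cotetrad_mul_tetrad hx) α) β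
      rwa [Matrix.mul_apply, Matrix.one_apply] at h
    · rw [orthoRiemann_eq hx, orthoRiemann_eq hx, riemannTable_antisymm]
    · rw [orthoRiemann_eq hx, orthoRiemann_eq hx, riemannTable_swap, Matrix.neg_apply]
    · rw [orthoRiemann_eq hx, orthoRiemann_eq hx]
      exact riemannTable_pair_symm hs _ _ _ _ rfl α β μ ν
    · rw [← kA_eq hx, orthoRiemann_eq hx]
      rfl
    · rw [← kD_eq hx, orthoRiemann_eq hx]
      simp [riemannTable]
    · rw [← kD_eq hx, orthoRiemann_eq hx]
      simp [riemannTable]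
    · rw [← kD_eq hx, orthoRiemann_eq hx]
      rfl
    · rintro α β (rfl | rfl) (rfl | rfl) <;> rw [← kC_eq hx, orthoRiemann_eq hx] <;> rfl
    · rw [← kB_eq hx, orthoRiemann_eq hx]
      rfl
    · rw [orthoRiemann_eq hx]
      exact riemannTable_eq_zero _ _ _ _ _ α β μ ν h1 h2
    · rw [orthoEinstein, einstein_metric hx, orthoMixed_diagonal hx, Matrix.diagonal_apply,
        Matrix.diagonal_apply, einsteinDiag, mul_ite, mul_zero]
    · rw [stress_eq hx, orthoMixed_diagonal hx, rho_eq hx, pr_eq hx, pt_eq hx]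
      rfl
    · rw [rho_eq hx, pr_eq hx, neg_neg]
    · rwa [rho_eq hx]
    · rw [hT, hsum', mul_neg_iff]
      constructor
      · intro h
        exact Or.inl ⟨hd, by linarith⟩
      · rintro (⟨-, h⟩ | ⟨h, -⟩) <;> linarith
    · rw [NEC_iff hm hℓ hx, not_le]
    · rw [hSEC, hsum, mul_neg_iff]
      constructor
      · intro h
        exact Or.inl ⟨hd, by linarith⟩
      · rintro (⟨-, h⟩ | ⟨h, -⟩) <;> linarith
    · have hr := hx.1
      rw [hT, hSEC, Xi_equatorial hr h, lt_div_iff₀ (show 0 < 2 * x 1 by positivity),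
        lt_div_iff₀ (show 0 < 2 * x 1 by positivity)]
      constructor <;> constructor <;> intro h <;> linarith
  · intro a δ hδ
    -- For ℓ equal to this value the bound ℓ (r² + a²) / (2 r³) on Ξ is 1 at r = δ. It is
    -- independent of m because Ξ is.
    refine ⟨2 * δ ^ 3 / (δ ^ 2 + a ^ 2), by positivity, fun m ℓ hm hℓ hℓ' x hx h => ?_⟩
    by_contra! hr
    have hX := Xi_le_one_of_le hδ hℓ hℓ' hr
    rw [NEC_iff hm hℓ hx, SEC_iff hm hℓ hx] at h
    rcases h with h | h
    · exact h (by linarith)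
    · exact h hX
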